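/- Let $m_1>m_2\ge 2$ and $q\ge 2$ be integers, $\mathcal A_1=\{0,\dots,m_1-1\}$, $\mathcal A_2=\{0,\dots,m_2-1\}$, and let $\Sigma=(\mathcal A_1\times\mathcal A_2)^{\mathbb N^*}$, with projection $\pi:\Sigma\to\mathcal A_2^{\mathbb N^*}$ onto the second coordinates. Put $\gamma=\log m_2/\log m_1$ and equip $\Sigma$ with the metric $$d\big((x,y),(u,v)\big)=\max\left(m_1^{-\min\{k\ge 0:(x_{k+1},y_{k+1})\ne(u_{k+1},v_{k+1})\}},\ m_1^{-\gamma\min\{k\ge 0:\,y_{k+1}\neq v_{k+1}\}}\right)$$ (with $m_1^{-\min\emptyset}=m_1^{-\gamma\min\emptyset}=0$). For a finite word $u$ write $[u]$ for the cylinder of all sequences beginning with $u$. Let $\Omega\subset\Sigma$ be closed and let $\mu$ be a Borel probability measure on $\Omega$, with disintegration $(\mu^y)_y$ with respect to $\pi$. Let $\mathbb P_\mu$ be the Borel probability measure on $\Sigma$ such that, for every word $u=u_1\cdots u_n$ over $\mathcal A_1\times\mathcal A_2$, $$\mathbb P_\mu([u])=\prod_{i\le n,\ q\nmid i}\mu\big([u_iu_{qi}\cdots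 u_{q^ri}]\big),\qquad q^ri\le n<q^{r+1}i .$$ Suppose that for every $p\ge1$ and every word $u=(x_1,y_1)\cdots(x_p,y_p)$ with $I=\Omega\cap[u]\neq\varnothing$, the map $y\mapsto\mu^y(I)$ is $\pi_*\mu$-almost surely constant on the cylinder $\pi([u])=[y_1\cdots y_p]$. Then the entropy dimensions $$\dim_e(\nu)=\lim_{n\to\infty}-\frac1n\sum_{|u|=n}\nu([u])\log\nu([u])$$ exist for $\nu=\mathbb P_\mu$ and for $\nu=\pi_*\mathbb P_\mu$ (the sum being over words of length $n$ over $\mathcal A_1\times\mathcal A_2$, respectively over $\mathcal A_2$), and $\mathbb P_\mu$ satisfies the Ledrappier–Young formula $$\dim_H(\mathbb P_\mu)=\frac1{\log m_1}\dim_e(\mathbb P_\mu)+\left(\frac1{\log m_2}-\frac1{\log m_1}\right)\dim_e(\pi_*\mathbb P_\mu),$$ where $\dim_H(\mathbb P_\mu)$ is, with the same value in both cases, the infimum of the Hausdorff dimensions with respect to $d$ of the Borel sets of positive $\mathbb P_\mu$-measure, or of those of full $\mathbb P_\mu$-measure. -/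

import Mathlib

open MeasureTheory ProbabilityTheory Filter Topology
open scoped ENNReal

namespace MulCarpet

/-- Infinite sequences over the alphabet `α`. The coordinate with index `k : ℕ` is the `(k+1)`-st
letter, so that positions `1, 2, 3, …` are the indices `0, 1, 2, …`. -/
abbrev Seq (α : Type*) := ℕ → α

/-- The symbolic space `({0, …, m₁ - 1} × {0, …, m₂ - 1})^{ℕ*}`. -/
abbrev Sig (m₁ m₂ : ℕ) := Seq (Fin m₁ × Fin m₂)

/-- The projection onto the second coordinate. -/
def proj {m₁ m₂ : ℕ} (z : Sig m₁ m₂) : Seq (Fin m₂) := fun k => (z k).2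

/-- The cylinder `[u]` of all sequences that begin with the word `u`. -/
def cyl {α : Type*} {n : ℕ} (u : Fin n → α) : Set (Seq α) := {z | ∀ k : Fin n, z k = u k}

/-- The words of length `p` that are prefixes of elements of `Ω`. -/
def Pref {α : Type*} (Ω : Set (Seq α)) (p : ℕ) : Set (Fin p → α) := {u | (Ω ∩ cyl u).Nonempty}

/-! ### The metric and the Hausdorff dimension -/

/-- `b ^ (- s * k)` where `k ≥ 0` is the number of letters before the first disagreement of `x`
and `y`, and `0` if `x = y`. -/
noncomputable def sepDist {α : Type*} (b s : ℝ) (x y : Seq α) : ℝ :=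
  open Classical in if x = y then 0 else b ^ (-s * (PiNat.firstDiff x y : ℝ))

section sepDist

variable {α : Type*} {b s : ℝ}

theorem sepDist_self (x : Seq α) : sepDist b s x x = 0 := by simp [sepDist]

theorem sepDist_comm (x y : Seq α) : sepDist b s x y = sepDist b s y x := by
  by_cases h : x = y
  · rw [h]
  · simp only [sepDist, h, Ne.symm h, if_false, PiNat.firstDiff_comm x y]

theorem sepDist_nonneg (hb : 1 ≤ b) (x y : Seq α) : 0 ≤ sepDist b s x y := by
  unfold sepDist
  split_ifs
  · exact le_rfl
  · positivity

theorem sepDist_le_max (hb : 1 ≤ b) (hs : 0 ≤ s) (x y z : Seq α) :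
    sepDist b s x z ≤ max (sepDist b s x y) (sepDist b s y z) := by
  by_cases hxz : x = z
  · subst hxz
    rw [sepDist_self]
    exact le_max_of_le_left (sepDist_nonneg hb _ _)
  by_cases hxy : x = y
  · subst hxy
    exact le_max_right _ _
  by_cases hyz : y = z
  · subst hyz
    exact le_max_left _ _
  have key := PiNat.min_firstDiff_le x y z hxz
  simp only [sepDist, hxz, hxy, hyz, if_false]
  rcases min_le_iff.1 key with h | h
  · refine le_max_of_le_left (Real.rpow_le_rpow_of_exponent_le hb ?_)
    have : (PiNat.firstDiff x y : ℝ) ≤ PiNat.firstDiff x z := by exact_mod_cast h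
    nlinarith
  · refine le_max_of_le_right (Real.rpow_le_rpow_of_exponent_le hb ?_)
    have : (PiNat.firstDiff y z : ℝ) ≤ PiNat.firstDiff x z := by exact_mod_cast h
    nlinarith

end sepDist

/-- `γ = log m₂ / log m₁`. -/
noncomputable def gam (m₁ m₂ : ℕ) : ℝ := Real.log m₂ / Real.log m₁

theorem gam_nonneg (m₁ m₂ : ℕ) : 0 ≤ gam m₁ m₂ :=
  div_nonneg (Real.log_natCast_nonneg _) (Real.log_natCast_nonneg _)

/-- The distance `max (m₁ ^ (-k), m₁ ^ (-γ k'))`, where `k` is the length of the longest common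
prefix of the two sequences of pairs, and `k'` that of the two sequences of second coordinates. -/
noncomputable def carpetDist {m₁ m₂ : ℕ} (z w : Sig m₁ m₂) : ℝ :=
  max (sepDist m₁ 1 z w) (sepDist m₁ (gam m₁ m₂) (proj z) (proj w))

theorem one_le_of_sig {m₁ m₂ : ℕ} (z : Sig m₁ m₂) : (1 : ℝ) ≤ m₁ := by
  have : 0 < m₁ := (z 0).1.pos
  exact_mod_cast this

/-- The symbolic space with the metric `carpetDist`, whose balls are the approximate squares. -/
noncomputable abbrev carpetMetric (m₁ m₂ : ℕ) : MetricSpace (Sig m₁ m₂) where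
  dist := carpetDist
  dist_self z := by simp [carpetDist, sepDist_self]
  dist_comm z w := by simp only [carpetDist, sepDist_comm z, sepDist_comm (proj z)]
  dist_triangle x y z := by
    have hb := one_le_of_sig x
    have h1 := sepDist_le_max hb zero_le_one x y z
    have h2 := sepDist_le_max hb (gam_nonneg m₁ m₂) (proj x) (proj y) (proj z)
    have hxy : 0 ≤ carpetDist x y := le_max_of_le_left (sepDist_nonneg hb _ _)
    have hyz : 0 ≤ carpetDist y z := le_max_of_le_left (sepDist_nonneg hb _ _)
    have h : carpetDist x z ≤ max (carpetDist x y) (carpetDist y z) :=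
      max_le (h1.trans (max_le_max (le_max_left _ _) (le_max_left _ _)))
        (h2.trans (max_le_max (le_max_right _ _) (le_max_right _ _)))
    exact h.trans (max_le_add_of_nonneg hxy hyz)
  eq_of_dist_eq_zero {x y} h := by
    by_contra hne
    have hb := one_le_of_sig x
    have h1 : 0 < sepDist (m₁ : ℝ) 1 x y := by
      simp only [sepDist, hne, if_false]
      positivity
    exact absurd h (lt_of_lt_of_le h1 (le_max_left _ _)).ne'

/-- The Hausdorff dimension of a subset of the symbolic space, for the metric `carpetDist`. -/
noncomputable def carpetDimH {m₁ m₂ : ℕ} (A : Set (Sig m₁ m₂)) : ℝ≥0∞ :=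
  letI := carpetMetric m₁ m₂
  dimH A

/-- The (lower) Hausdorff dimension of a measure: the infimum of the Hausdorff dimensions of the
Borel sets of positive measure. -/
noncomputable def lowerDimH {m₁ m₂ : ℕ} (ν : Measure (Sig m₁ m₂)) : ℝ≥0∞ :=
  ⨅ (A : Set (Sig m₁ m₂)) (_ : MeasurableSet A) (_ : ν A ≠ 0), carpetDimH A

/-- The upper Hausdorff dimension of a measure: the infimum of the Hausdorff dimensions of the
Borel sets of full measure. -/
noncomputable def upperDimH {m₁ m₂ : ℕ} (ν : Measure (Sig m₁ m₂)) : ℝ≥0∞ :=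
  ⨅ (A : Set (Sig m₁ m₂)) (_ : MeasurableSet A) (_ : ν Aᶜ = 0), carpetDimH A

/-! ### Entropy dimension and disintegration -/

/-- `ν` has entropy dimension `e`: the limit of `-(1/n) ∑ ν[u] log ν[u]`, the sum over all words
`u` of length `n`, exists and equals `e`. -/
def HasEntropyDim {α : Type*} [Fintype α] [MeasurableSpace α] (ν : Measure (Seq α)) (e : ℝ) :
    Prop :=
  Tendsto (fun n : ℕ => -(1 / (n : ℝ)) *
    ∑ u : Fin n → α, ν.real (cyl u) * Real.log (ν.real (cyl u))) atTop (𝓝 e)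

/-- The disintegration `y ↦ μ^y` of `μ` with respect to the projection `proj`. -/
noncomputable def disint {m₁ m₂ : ℕ} (μ : Measure (Sig m₁ m₂)) [IsProbabilityMeasure μ] :
    Kernel (Seq (Fin m₂)) (Sig m₁ m₂) :=
  haveI : Nonempty (Sig m₁ m₂) := μ.nonempty_of_neZero
  condDistrib id proj μ

/-! ### The measure `ℙ_μ` -/

/-- Glue the sequences `ω i`, `q ∤ i`, along the progressions `i, q i, q² i, …`: the letter at
position `n = q ^ r * i`, `q ∤ i`, is the `(r+1)`-st letter of `ω i`.
(The sequences `ω i` with `q ∣ i` are not used.) -/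
noncomputable def glue {α : Type*} (q : ℕ) (ω : ℕ → Seq α) : Seq α := fun k =>
  ω ((k + 1) / q ^ multiplicity q (k + 1)) (multiplicity q (k + 1))

theorem measurable_glue {α : Type*} [MeasurableSpace α] (q : ℕ) :
    Measurable (glue (α := α) q) := by
  unfold glue
  fun_prop

/-- The measure `ℙ_μ`: the restrictions of a `ℙ_μ`-random sequence to the progressions
`i, q i, q² i, …` with `q ∤ i` are independent with law `μ`. -/
noncomputable def mulMeasure {α : Type*} [MeasurableSpace α] (q : ℕ) (μ : Measure (Seq α)) :
    Measure (Seq α) :=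
  (Measure.infinitePi fun _ : ℕ => μ).map (glue q)

/-- The set `[u|_{J_i}]` of all sequences that begin with `u_i u_{q i} u_{q² i} ⋯`, the subword of
`u` at the positions `i q ^ r ≤ n` (the letter at position `l` is `u` at the index `l - 1`). -/
def progCyl {α : Type*} (q : ℕ) {n : ℕ} (u : Fin n → α) (i : ℕ) : Set (Seq α) :=
  {z | ∀ (r : ℕ) (k : Fin n), (k : ℕ) + 1 = q ^ r * i → z r = u k}

theorem glue_mem_cyl {α : Type*} {q : ℕ} (hq : 2 ≤ q) {n : ℕ} (u : Fin n → α)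
    (ω : ℕ → Seq α) :
    glue q ω ∈ cyl u ↔ ∀ i ∈ (Finset.Icc 1 n).filter (fun i => ¬ q ∣ i), ω i ∈ progCyl q u i := by
  have hfin : ∀ m : ℕ, 0 < m → FiniteMultiplicity q m := fun m hm =>
    Nat.finiteMultiplicity_iff.2 ⟨by omega, hm⟩
  constructor
  · intro h i hi r k hk
    obtain ⟨hi1, hi2⟩ := Finset.mem_filter.1 hi
    have hi0 : 0 < i := (Finset.mem_Icc.1 hi1).1
    have hm : multiplicity q ((k : ℕ) + 1) = r := by
      rw [hk]
      refine (multiplicity_eq_of_dvd_of_not_dvd (dvd_mul_right _ _) ?_)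
      rw [pow_succ]
      intro hd
      exact hi2 (Nat.dvd_of_mul_dvd_mul_left (by positivity) hd)
    have := h k
    rw [glue, hm, hk, Nat.mul_div_cancel_left _ (by positivity)] at this
    exact this
  · intro h k
    obtain ⟨c, hc, hnd⟩ := (hfin ((k : ℕ) + 1) (by omega)).exists_eq_pow_mul_and_not_dvd
    set r := multiplicity q ((k : ℕ) + 1) with hr
    have hpos : 0 < q ^ r := by positivity
    have hc0 : 0 < c := Nat.pos_of_ne_zero (by rintro rfl; simp at hnd)
    have hcn : c ≤ n := by
      have h1 : c ≤ q ^ r * c := Nat.le_mul_of_pos_left _ hpos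
      have h2 := k.2
      omega
    have hdiv : ((k : ℕ) + 1) / q ^ r = c := by
      rw [hc, Nat.mul_div_cancel_left _ hpos]
    have := h c (Finset.mem_filter.2 ⟨Finset.mem_Icc.2 ⟨hc0, hcn⟩, hnd⟩) r k hc
    simp only [glue, ← hr, hdiv]
    exact this

theorem measurableSet_cyl {α : Type*} [MeasurableSpace α] [MeasurableSingletonClass α] {n : ℕ}
    (u : Fin n → α) : MeasurableSet (cyl u) := by
  simp only [cyl, Set.ofPred_forall]
  exact MeasurableSet.iInter fun k => measurable_pi_apply _ (measurableSet_singleton _)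

theorem measurableSet_progCyl {α : Type*} [MeasurableSpace α] [MeasurableSingletonClass α]
    (q : ℕ) {n : ℕ} (u : Fin n → α) (i : ℕ) : MeasurableSet (progCyl q u i) := by
  simp only [progCyl, Set.ofPred_forall]
  exact MeasurableSet.iInter fun r => MeasurableSet.iInter fun k => MeasurableSet.iInter fun _ =>
    measurable_pi_apply _ (measurableSet_singleton _)

/-- The defining formula of `ℙ_μ` on cylinders: `ℙ_μ [u] = ∏_{i ≤ n, q ∤ i} μ [u|_{J_i}]`. -/
theorem mulMeasure_cyl {α : Type*} [MeasurableSpace α] [MeasurableSingletonClass α] {q : ℕ}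
    (hq : 2 ≤ q) (μ : Measure (Seq α)) [IsProbabilityMeasure μ] {n : ℕ} (u : Fin n → α) :
    mulMeasure q μ (cyl u) =
      ∏ i ∈ (Finset.Icc 1 n).filter (fun i => ¬ q ∣ i), μ (progCyl q u i) := by
  rw [mulMeasure, Measure.map_apply (measurable_glue q) (measurableSet_cyl u)]
  have : glue q ⁻¹' cyl u =
      Set.pi ((Finset.Icc 1 n).filter (fun i => ¬ q ∣ i) : Finset ℕ) (progCyl q u) := by
    ext ω
    simp only [Set.mem_preimage, glue_mem_cyl hq, Set.mem_pi, Finset.mem_coe]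
  rw [this, Measure.infinitePi_pi _ (fun i _ => measurableSet_progCyl q u i)]

end MulCarpet

namespace MulCarpet

/-! Under `ℙ_μ` the letters along the progressions `i, q i, q² i, …` with `q ∤ i` are independent
samples `ω i` of `μ`. So the information `-log ℙ_μ[z₁ ⋯ z_n]` is almost surely a sum of independent
terms, one per starting point `i`, each depending only on the first `progLen q n i` letters of `ω
i`. Progressions with more than `r` terms have density `q^{-r} - q^{-(r+1)}`. Hence the mean divided
by `n` converges and the variance is `O(n)`, which gives a Shannon–McMillan–Breiman theorem
(`exists_hasEntropyDim_and_ae_tendsto`). It applies to the projection as well, since projecting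
commutes with gluing (`map_proj_mulMeasure`).

A ball of radius `m₁^{-n}` is an approximate square: it fixes `n` letters and the first `L = ⌈n/γ⌉`
second coordinates. Constancy of the fibre measures makes the measure of a square a product of
cylinder measures up to division (`FiberConst.measure_square_mul`), progression by progression.
Writing `I_n` and `I'_n` for the informations of `ℙ_μ` and of its projection, `-log` of the measure
of the square is `I_n + I'_L - I'_n` (`FiberConst.ae_neg_log_square`). Dividing by `n`, with `L/n →
log m₁ / log m₂`, gives an almost surely constant local dimension. A Billingsley argument
(`dimH_eq_of_ae_tendsto`) turns it into both Hausdorff dimensions. -/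

/-! ### Counting along the progressions `i, q i, q² i, …` -/

/-- The number of terms of the progression `i, q i, q² i, …` that are at most `n`. -/
def progLen (q n i : ℕ) : ℕ := Nat.clog q (n / i + 1)

/-- The starting points, up to `n`, of the progressions of ratio `q`. -/
def starts (q n : ℕ) : Finset ℕ := (Finset.Icc 1 n).filter (fun i => ¬ q ∣ i)

theorem one_le_of_mem_starts {q n i : ℕ} (hi : i ∈ starts q n) : 1 ≤ i :=
  (Finset.mem_Icc.1 (Finset.mem_filter.1 hi).1).1

theorem lt_progLen_iff {q n i r : ℕ} (hq : 2 ≤ q) (hi : 1 ≤ i) :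
    r < progLen q n i ↔ q ^ r * i ≤ n := by
  rw [progLen, Nat.lt_clog_iff_pow_lt hq, Nat.lt_succ_iff, Nat.le_div_iff_mul_le hi]

theorem progLen_le {q n i : ℕ} (hq : 2 ≤ q) (hi : 1 ≤ i) : progLen q n i ≤ n := by
  by_contra! h
  have h1 := (lt_progLen_iff hq hi).1 h
  have h2 : n < q ^ n := Nat.lt_pow_self hq
  nlinarith

/-- These starting points are the non-multiples of `q` in `(0, n / q ^ r]`, and the multiples there
number `n / q ^ (r + 1)`. The additive form avoids truncated subtraction. -/
theorem card_starts_le_div {q n r : ℕ} (hq : 2 ≤ q) :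
    ((starts q n).filter fun i => q ^ r * i ≤ n).card + n / q ^ (r + 1) = n / q ^ r := by
  have hpos : 0 < q ^ r := by positivity
  have h1 : (starts q n).filter (fun i => q ^ r * i ≤ n) =
      (Finset.Ioc 0 (n / q ^ r)).filter fun i => ¬ q ∣ i := by
    ext i
    simp only [starts, Finset.mem_filter, Finset.mem_Icc, Finset.mem_Ioc,
      Nat.le_div_iff_mul_le hpos, mul_comm i]
    have : i ≤ q ^ r * i := Nat.le_mul_of_pos_left _ hpos
    constructor
    · rintro ⟨⟨⟨h1, h2⟩, h3⟩, h4⟩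
      exact ⟨⟨by omega, h4⟩, h3⟩
    · rintro ⟨⟨h1, h4⟩, h3⟩
      exact ⟨⟨⟨by omega, by omega⟩, h3⟩, h4⟩
  have h2 := Nat.Ioc_filter_dvd_card_eq_div (n / q ^ r) q
  have h3 := Finset.card_filter_add_card_filter_not (s := Finset.Ioc 0 (n / q ^ r)) (q ∣ ·)
  rw [Nat.card_Ioc] at h3
  rw [h1, pow_succ, ← Nat.div_div_eq_div_mul]
  generalize n / q ^ r = M at h2 h3 ⊢
  generalize M / q = K at h2 ⊢
  omega

/-- Summation by parts: `h (progLen q n i)` telescopes, and the increment at `r` occurs once for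
each start with `q ^ r * i ≤ n`. -/
theorem sum_progLen {q : ℕ} (hq : 2 ≤ q) (h : ℕ → ℝ) (h0 : h 0 = 0) (n : ℕ) :
    ∑ i ∈ starts q n, h (progLen q n i) =
      ∑ r ∈ Finset.range n,
        (h (r + 1) - h r) * (((n / q ^ r : ℕ) : ℝ) - ((n / q ^ (r + 1) : ℕ) : ℝ)) := by
  have h1 : ∀ i ∈ starts q n, h (progLen q n i) =
      ∑ r ∈ Finset.range n, if q ^ r * i ≤ n then h (r + 1) - h r else 0 := by
    intro i hi
    have hi1 := one_le_of_mem_starts hi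
    rw [← Finset.sum_filter]
    have : (Finset.range n).filter (fun r => q ^ r * i ≤ n) = Finset.range (progLen q n i) := by
      ext r
      simp only [Finset.mem_filter, Finset.mem_range, ← lt_progLen_iff hq hi1]
      have := progLen_le hq hi1 (n := n)
      omega
    rw [this, Finset.sum_range_sub, h0, sub_zero]
  rw [Finset.sum_congr rfl h1, Finset.sum_comm]
  refine Finset.sum_congr rfl fun r _ => ?_
  rw [← Finset.sum_filter, Finset.sum_const, nsmul_eq_mul, mul_comm]
  congr 1
  rw [← card_starts_le_div hq (r := r) (n := n)]
  push_cast
  ring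

theorem tendsto_natCast_div_pow_div {q : ℕ} (r : ℕ) :
    Tendsto (fun n : ℕ => ((n / q ^ r : ℕ) : ℝ) / n) atTop (𝓝 (1 / (q : ℝ) ^ r)) := by
  have h := (tendsto_nat_floor_mul_div_atTop (R := ℝ) (a := 1 / (q : ℝ) ^ r)
    (by positivity)).comp tendsto_natCast_atTop_atTop
  refine h.congr fun n => ?_
  simp only [Function.comp]
  rw [← Nat.floor_div_eq_div (K := ℝ) n (q ^ r)]
  push_cast
  rw [one_div_mul_eq_div]

/-- Averages along the progressions converge for a weight of at most quadratic growth. -/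
theorem exists_tendsto_sum_progLen_div {q : ℕ} (hq : 2 ≤ q) (h : ℕ → ℝ) (K : ℝ)
    (hK : ∀ p, |h p| ≤ K * (p : ℝ) ^ 2) :
    ∃ l, Tendsto (fun n : ℕ => (∑ i ∈ starts q n, h (progLen q n i)) / n) atTop (𝓝 l) := by
  have h0 : h 0 = 0 := by simpa using hK 0
  have hq0 : (0 : ℝ) < q := by positivity
  have hK0 : 0 ≤ K := by simpa using (abs_nonneg _).trans (hK 1)
  have hf : ∀ r : ℕ, |h (r + 1) - h r| ≤ 2 * K * ((r + 1 : ℕ) : ℝ) ^ 2 := by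
    intro r
    have h1 := hK (r + 1)
    have h2 := hK r
    have h3 : K * (r : ℝ) ^ 2 ≤ K * ((r + 1 : ℕ) : ℝ) ^ 2 := by
      push_cast
      gcongr
      linarith
    have := abs_sub (h (r + 1)) (h r)
    linarith
  have hlt : ‖(1 / (q : ℝ))‖ < 1 := by
    rw [Real.norm_of_nonneg (by positivity), div_lt_one hq0]
    exact_mod_cast hq
  have hsum : Summable fun r : ℕ => 2 * K * ((r + 1 : ℕ) : ℝ) ^ 2 * (1 / (q : ℝ) ^ r) := by
    have h1 : Summable fun r : ℕ => ((r + 1 : ℕ) : ℝ) ^ 2 * (1 / (q : ℝ)) ^ (r + 1) :=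
      (summable_nat_add_iff (f := fun r : ℕ => (r : ℝ) ^ 2 * (1 / (q : ℝ)) ^ r) 1).2
        (summable_pow_mul_geometric_of_norm_lt_one 2 hlt)
    refine (h1.mul_left (2 * K * q)).congr fun r => ?_
    rw [div_pow, one_pow, pow_succ (q : ℝ) r]
    field_simp
  -- Dominated convergence for series: the density quotient at `r` is at most `q^{-r}`, while the
  -- increments of `h` grow at most quadratically.
  have key := tendsto_tsum_of_dominated_convergence (𝓕 := atTop) (G := ℝ)
    (f := fun n r => (h (r + 1) - h r) *
      ((((n / q ^ r : ℕ) : ℝ) - ((n / q ^ (r + 1) : ℕ) : ℝ)) / n))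
    (g := fun r => (h (r + 1) - h r) * (1 / (q : ℝ) ^ r - 1 / (q : ℝ) ^ (r + 1))) hsum
    (fun r => ?_) (Eventually.of_forall fun n r => ?_)
  · refine ⟨_, key.congr fun n => ?_⟩
    rw [tsum_eq_sum (s := Finset.range n), sum_progLen hq h h0, Finset.sum_div]
    · exact Finset.sum_congr rfl fun r _ => by rw [mul_div_assoc]
    -- Both integer quotients vanish for `r ≥ n`, so the finite sum is the whole series.
    · intro r hr
      have hr' : n ≤ r := by simpa using hr
      have h1 : n < q ^ r := hr'.trans_lt (Nat.lt_pow_self hq)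
      have h2 : n < q ^ (r + 1) := by
        have : n ≤ r + 1 := by omega
        exact this.trans_lt (Nat.lt_pow_self hq)
      rw [Nat.div_eq_of_lt h1, Nat.div_eq_of_lt h2]
      simp
  · refine Tendsto.const_mul _ ?_
    simp_rw [sub_div]
    exact (tendsto_natCast_div_pow_div r).sub (tendsto_natCast_div_pow_div (r + 1))
  · rw [norm_mul]
    refine mul_le_mul (hf r) ?_ (norm_nonneg _) (by positivity)
    have h1 : ((n / q ^ (r + 1) : ℕ) : ℝ) ≤ ((n / q ^ r : ℕ) : ℝ) := by
      exact_mod_cast (card_starts_le_div hq (n := n) (r := r)) ▸ Nat.le_add_left _ _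
    have h2 : ((n / q ^ r : ℕ) : ℝ) ≤ (n : ℝ) / (q : ℝ) ^ r := by
      exact_mod_cast Nat.cast_div_le (α := ℝ) (m := n) (n := q ^ r)
    have h3 : (0 : ℝ) ≤ ((n / q ^ (r + 1) : ℕ) : ℝ) := by positivity
    rw [Real.norm_of_nonneg (div_nonneg (by linarith) (by positivity))]
    rcases Nat.eq_zero_or_pos n with rfl | hn
    · simp
    · have hn' : (0 : ℝ) < n := by exact_mod_cast hn
      rw [div_le_iff₀ hn']
      calc _ ≤ (n : ℝ) / (q : ℝ) ^ r := by linarith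
        _ = _ := by ring

/-! ### Information functions -/

/-- The word formed by the first `n` letters. -/
def restr {α : Type*} (n : ℕ) (z : Seq α) : Fin n → α := fun k => z k

theorem cyl_eq_preimage {α : Type*} {n : ℕ} (u : Fin n → α) : cyl u = restr n ⁻¹' {u} := by
  ext z
  simp [cyl, restr, funext_iff]

theorem cyl_restr {α : Type*} (n : ℕ) (z : Seq α) : cyl (restr n z) = PiNat.cylinder z n := by
  ext w
  simp only [cyl, restr, PiNat.cylinder, Set.mem_ofPred_eq]
  exact ⟨fun h i hi => h ⟨i, hi⟩, fun h k => h k k.2⟩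

/-- The information `-log ν[z₁ ⋯ z_n]`. -/
noncomputable def info {α : Type*} [MeasurableSpace α] (ν : Measure (Seq α)) (n : ℕ) (z : Seq α) :
    ℝ := -Real.log (ν.real (PiNat.cylinder z n))

/-- The entropy of the partition into cylinders of length `n`. -/
noncomputable def ent {α : Type*} [MeasurableSpace α] (ν : Measure (Seq α)) (n : ℕ) : ℝ :=
  ∫ z, info ν n z ∂ν

section Info

variable {α : Type*} [MeasurableSpace α]

theorem info_nonneg {ν : Measure (Seq α)} [IsProbabilityMeasure ν] (n : ℕ) (z : Seq α) :
    0 ≤ info ν n z :=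
  neg_nonneg.2 (Real.log_nonpos measureReal_nonneg measureReal_le_one)

theorem info_zero {ν : Measure (Seq α)} [IsProbabilityMeasure ν] (z : Seq α) :
    info ν 0 z = 0 := by
  simp [info]

theorem measurable_restr (n : ℕ) : Measurable (restr (α := α) n) := by
  unfold restr
  fun_prop

/-- The information depends only on a finite word; over a finite alphabet this settles its
measurability and boundedness. -/
theorem info_eq (ν : Measure (Seq α)) (n : ℕ) (z : Seq α) :
    info ν n z = (fun u : Fin n → α => -Real.log (ν.real (cyl u))) (restr n z) := by
  simp only [info, cyl_restr]

/-- There are finitely many words of each length, so the null cylinders have a null union. Off it,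
the convention `Real.log 0 = 0` never interferes. -/
theorem ae_cylinder_ne_zero [Fintype α] (ν : Measure (Seq α)) [IsFiniteMeasure ν] :
    ∀ᵐ z ∂ν, ∀ n, ν.real (PiNat.cylinder z n) ≠ 0 := by
  refine ae_all_iff.2 fun n => ?_
  have h : ∀ u : Fin n → α, ∀ᵐ z ∂ν, z ∈ cyl u → ν.real (cyl u) ≠ 0 := by
    intro u
    by_cases hu : ν.real (cyl u) = 0
    · have : ν (cyl u) = 0 := (measureReal_eq_zero_iff (measure_ne_top _ _)).1 hu
      filter_upwards [measure_eq_zero_iff_ae_notMem.1 this] with z hz hz'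
      exact absurd hz' hz
    · exact Eventually.of_forall fun _ _ => hu
  filter_upwards [ae_all_iff.2 h] with z hz
  have h1 := hz (restr n z)
  rw [cyl_restr] at h1
  exact h1 (PiNat.self_mem_cylinder z n)

theorem ent_nonneg (ν : Measure (Seq α)) [IsProbabilityMeasure ν] (p : ℕ) : 0 ≤ ent ν p :=
  integral_nonneg fun z => info_nonneg p z

variable [Fintype α] [MeasurableSingletonClass α]

theorem measurable_comp_restr {β : Type*} [MeasurableSpace β] {n : ℕ} (g : (Fin n → α) → β) :
    Measurable fun z : Seq α => g (restr n z) :=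
  (measurable_of_finite g).comp (measurable_restr n)

theorem measurable_info (ν : Measure (Seq α)) (n : ℕ) : Measurable (info ν n) := by
  rw [funext (info_eq ν n)]
  exact measurable_comp_restr fun u => -Real.log (ν.real (cyl u))

theorem memLp_comp_restr (ν : Measure (Seq α)) [IsFiniteMeasure ν] {n : ℕ}
    (g : (Fin n → α) → ℝ) (p : ℝ≥0∞) : MemLp (fun z => g (restr n z)) p ν := by
  refine MemLp.of_bound (measurable_comp_restr g).aestronglyMeasurable (∑ u, ‖g u‖)
    (Eventually.of_forall fun z => ?_)
  exact Finset.single_le_sum (f := fun u => ‖g u‖) (fun _ _ => norm_nonneg _)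
    (Finset.mem_univ (restr n z))

theorem memLp_info (ν μ : Measure (Seq α)) [IsFiniteMeasure ν] (n : ℕ) (p : ℝ≥0∞) :
    MemLp (info μ n) p ν := by
  rw [funext (info_eq μ n)]
  exact memLp_comp_restr ν (fun u => -Real.log (μ.real (cyl u))) p

theorem integral_comp_restr (ν : Measure (Seq α)) [IsFiniteMeasure ν] {n : ℕ}
    (g : (Fin n → α) → ℝ) : ∫ z, g (restr n z) ∂ν = ∑ u, ν.real (cyl u) * g u := by
  rw [← integral_map (measurable_restr n).aemeasurable
    (measurable_of_finite g).aestronglyMeasurable, integral_fintype Integrable.of_finite]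
  refine Finset.sum_congr rfl fun u _ => ?_
  rw [map_measureReal_apply (measurable_restr n) (measurableSet_singleton u), ← cyl_eq_preimage,
    smul_eq_mul]

theorem ent_eq (ν : Measure (Seq α)) [IsFiniteMeasure ν] (n : ℕ) :
    ent ν n = -∑ u : Fin n → α, ν.real (cyl u) * Real.log (ν.real (cyl u)) := by
  rw [ent, funext (info_eq ν n), integral_comp_restr, ← Finset.sum_neg_distrib]
  exact Finset.sum_congr rfl fun u _ => by ring

theorem hasEntropyDim_iff (ν : Measure (Seq α)) [IsFiniteMeasure ν] (e : ℝ) :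
    HasEntropyDim ν e ↔ Tendsto (fun n : ℕ => ent ν n / n) atTop (𝓝 e) := by
  unfold HasEntropyDim
  refine tendsto_congr fun n => ?_
  rw [ent_eq]
  ring

theorem sum_measureReal_cyl (ν : Measure (Seq α)) [IsProbabilityMeasure ν] (n : ℕ) :
    ∑ u : Fin n → α, ν.real (cyl u) = 1 := by
  have := integral_comp_restr ν (n := n) fun _ => 1
  simpa using this.symm

/-- `x log² x` on `[0, 1]`, split according to the size of `-log x`. -/
theorem mul_log_sq_le {x a : ℝ} (hx0 : 0 ≤ x) (hx1 : x ≤ 1) :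
    x * (-Real.log x) ^ 2 ≤ 4 * a ^ 2 * x + 16 * Real.exp (-a) := by
  rcases hx0.eq_or_lt with rfl | hx
  · simp only [zero_mul, mul_zero, zero_add]
    positivity
  set l := -Real.log x with hl
  have hl0 : 0 ≤ l := neg_nonneg.2 (Real.log_nonpos hx0 hx1)
  have hxl : x = Real.exp (-l) := by rw [hl, neg_neg, Real.exp_log hx]
  -- Beyond this threshold, `l² ≤ 16 e^{l/2}` leaves `x l² ≤ 16 e^{-l/2} ≤ 16 e^{-a}`.
  by_cases h : l ≤ 2 * a
  · have h1 : l ^ 2 ≤ 4 * a ^ 2 := by nlinarith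
    have h2 : x * l ^ 2 ≤ x * (4 * a ^ 2) := by gcongr
    have := Real.exp_pos (-a)
    nlinarith
  · have h1 : l ≤ 4 * Real.exp (l / 4) := by
      have := Real.add_one_le_exp (l / 4)
      linarith
    have h2 : l ^ 2 ≤ 16 * Real.exp (l / 2) := by
      calc l ^ 2 ≤ (4 * Real.exp (l / 4)) ^ 2 := by gcongr
        _ = 16 * (Real.exp (l / 4) * Real.exp (l / 4)) := by ring
        _ = 16 * Real.exp (l / 2) := by rw [← Real.exp_add]; ring_nf
    have h3 : x * l ^ 2 ≤ 16 * Real.exp (-a) := by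
      calc x * l ^ 2 ≤ x * (16 * Real.exp (l / 2)) := by gcongr
        _ = 16 * (Real.exp (-l) * Real.exp (l / 2)) := by rw [hxl]; ring
        _ = 16 * Real.exp (-l + l / 2) := by rw [Real.exp_add]
        _ ≤ 16 * Real.exp (-a) := by
          gcongr
          linarith
    have : 0 ≤ 4 * a ^ 2 * x := by positivity
    linarith

/-- The second moment of the information grows at most quadratically. -/
theorem integral_info_sq_le (ν : Measure (Seq α)) [IsProbabilityMeasure ν] (p : ℕ) :
    ∫ z, info ν p z ^ 2 ∂ν ≤ (4 * Real.log (Fintype.card α) ^ 2 + 16) * (p : ℝ) ^ 2 := by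
  rcases Nat.eq_zero_or_pos p with rfl | hp
  · simp [info_zero]
  have hne : Nonempty α := by
    obtain ⟨z⟩ := ν.nonempty_of_neZero
    exact ⟨z 0⟩
  have hcard : (0 : ℝ) < Fintype.card α := by exact_mod_cast Fintype.card_pos
  simp_rw [info_eq]
  rw [integral_comp_restr ν (n := p) fun u => (-Real.log (ν.real (cyl u))) ^ 2]
  -- The choice `a = p log |α|` makes `e^{-a}` the inverse of the number of words, so the error
  -- terms add up to `16`.
  calc _ ≤ ∑ u : Fin p → α, (4 * (p * Real.log (Fintype.card α)) ^ 2 * ν.real (cyl u) +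
        16 * Real.exp (-(p * Real.log (Fintype.card α)))) :=
      Finset.sum_le_sum fun u _ => mul_log_sq_le measureReal_nonneg measureReal_le_one
    _ = 4 * Real.log (Fintype.card α) ^ 2 * (p : ℝ) ^ 2 + 16 := by
      rw [Finset.sum_add_distrib, ← Finset.mul_sum, sum_measureReal_cyl, Finset.sum_const,
        Finset.card_univ, Fintype.card_fun, Fintype.card_fin, Real.exp_neg, Real.exp_nat_mul,
        Real.exp_log hcard, nsmul_eq_mul]
      push_cast
      field_simp
    _ ≤ _ := by
      have : (1 : ℝ) ≤ p := by exact_mod_cast hp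
      nlinarith

/-- Follows from `x ≤ 1 + x²` and the second moment; quadratic growth is all that
`exists_tendsto_sum_progLen_div` needs. -/
theorem abs_ent_le (ν : Measure (Seq α)) [IsProbabilityMeasure ν] (p : ℕ) :
    |ent ν p| ≤ (4 * Real.log (Fintype.card α) ^ 2 + 17) * (p : ℝ) ^ 2 := by
  rw [abs_of_nonneg (ent_nonneg ν p)]
  rcases Nat.eq_zero_or_pos p with rfl | hp
  · simp [ent, info_zero]
  have h1 : ent ν p ≤ ∫ z, (1 + info ν p z ^ 2) ∂ν := by
    refine integral_mono ((memLp_info ν ν p 1).integrable le_rfl)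
      ((integrable_const 1).add (memLp_info ν ν p 2).integrable_sq) fun z => ?_
    nlinarith [sq_nonneg (info ν p z - 1), info_nonneg (ν := ν) p z]
  rw [integral_add (integrable_const 1) (memLp_info ν ν p 2).integrable_sq] at h1
  simp only [integral_const, probReal_univ, smul_eq_mul, mul_one] at h1
  have h2 := integral_info_sq_le ν p
  have : (1 : ℝ) ≤ p := by exact_mod_cast hp
  nlinarith

end Info

/-! ### The measure `ℙ_μ` on cylinders -/

section Glue

variable {α : Type*}

theorem glue_apply {q : ℕ} (hq : 2 ≤ q) (ω : ℕ → Seq α) {i r k : ℕ} (hi : ¬ q ∣ i)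
    (hk : k + 1 = q ^ r * i) : glue q ω k = ω i r := by
  have hpos : 0 < q ^ r := by positivity
  have hm : multiplicity q (k + 1) = r := by
    rw [hk]
    refine multiplicity_eq_of_dvd_of_not_dvd (dvd_mul_right _ _) ?_
    rw [pow_succ]
    exact fun hd => hi (Nat.dvd_of_mul_dvd_mul_left hpos hd)
  rw [glue, hm, hk, Nat.mul_div_cancel_left _ hpos]

theorem progCyl_restr_glue {q : ℕ} (hq : 2 ≤ q) (ω : ℕ → Seq α) {n i : ℕ}
    (hi1 : 1 ≤ i) (hi : ¬ q ∣ i) :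
    progCyl q (restr n (glue q ω)) i = PiNat.cylinder (ω i) (progLen q n i) := by
  ext z
  simp only [progCyl, PiNat.cylinder, Set.mem_ofPred_eq, restr, lt_progLen_iff hq hi1]
  constructor
  · intro h r hr
    have hpos : 0 < q ^ r * i := by positivity
    have hk : (q ^ r * i - 1) + 1 = q ^ r * i := by omega
    rw [h r ⟨q ^ r * i - 1, by omega⟩ hk, glue_apply hq ω hi hk]
  · intro h r k hk
    rw [h r (by have := k.2; omega), glue_apply hq ω hi hk]

theorem mem_starts {q n i : ℕ} : i ∈ starts q n ↔ (1 ≤ i ∧ i ≤ n) ∧ ¬ q ∣ i := by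
  simp [starts]

theorem starts_mono {q n N : ℕ} (h : n ≤ N) : starts q n ⊆ starts q N := fun i hi => by
  rw [mem_starts] at hi ⊢
  exact ⟨⟨hi.1.1, hi.1.2.trans h⟩, hi.2⟩

theorem progLen_eq_zero {q n i : ℕ} (hi : n < i) : progLen q n i = 0 := by
  simp [progLen, Nat.div_eq_of_lt hi]

/-- Starts in `(n, N]` have `progLen` zero and impose no condition. The freedom in `N` lets
cylinders of different lengths be factored over one index set. -/
theorem glue_mem_cylinder_glue {q : ℕ} (hq : 2 ≤ q) (ω ω' : ℕ → Seq α) {n N : ℕ} (hn : n ≤ N) :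
    glue q ω' ∈ PiNat.cylinder (glue q ω) n ↔
      ∀ i ∈ starts q N, ω' i ∈ PiNat.cylinder (ω i) (progLen q n i) := by
  rw [← cyl_restr, glue_mem_cyl hq]
  constructor
  · intro h i hi
    obtain ⟨hi1, hi2⟩ := mem_starts.1 hi
    by_cases hin : i ≤ n
    · rw [← progCyl_restr_glue hq ω hi1.1 hi2]
      exact h i (mem_starts.2 ⟨⟨hi1.1, hin⟩, hi2⟩)
    · rw [progLen_eq_zero (by omega)]
      simp
  · intro h i hi
    obtain ⟨hi1, hi2⟩ := mem_starts.1 hi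
    rw [progCyl_restr_glue hq ω hi1.1 hi2]
    exact h i (starts_mono hn hi)

variable [MeasurableSpace α] [MeasurableSingletonClass α]

theorem measurableSet_cylinder (z : Seq α) (n : ℕ) : MeasurableSet (PiNat.cylinder z n) := by
  rw [← cyl_restr]
  exact measurableSet_cyl _

instance (q : ℕ) (μ : Measure (Seq α)) [IsProbabilityMeasure μ] :
    IsProbabilityMeasure (mulMeasure q μ) :=
  Measure.isProbabilityMeasure_map (measurable_glue q).aemeasurable

theorem mulMeasure_real_cylinder_glue {q : ℕ} (hq : 2 ≤ q) (μ : Measure (Seq α))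
    [IsProbabilityMeasure μ] (ω : ℕ → Seq α) {n N : ℕ} (hn : n ≤ N) :
    (mulMeasure q μ).real (PiNat.cylinder (glue q ω) n) =
      ∏ i ∈ starts q N, μ.real (PiNat.cylinder (ω i) (progLen q n i)) := by
  have : glue q ⁻¹' PiNat.cylinder (glue q ω) n =
      Set.pi (starts q N : Set ℕ) fun i => PiNat.cylinder (ω i) (progLen q n i) := by
    ext ω'
    simp only [Set.mem_preimage, glue_mem_cylinder_glue hq ω ω' hn, Set.mem_pi, Finset.mem_coe]
  rw [measureReal_def, mulMeasure, Measure.map_apply (measurable_glue q)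
    (measurableSet_cylinder _ _), this, Measure.infinitePi_pi _
    (fun i _ => measurableSet_cylinder _ _), ENNReal.toReal_prod]
  rfl

theorem info_mulMeasure_glue {q : ℕ} (hq : 2 ≤ q) (μ : Measure (Seq α))
    [IsProbabilityMeasure μ] (ω : ℕ → Seq α) (n : ℕ)
    (h : (mulMeasure q μ).real (PiNat.cylinder (glue q ω) n) ≠ 0) :
    info (mulMeasure q μ) n (glue q ω) = ∑ i ∈ starts q n, info μ (progLen q n i) (ω i) := by
  rw [mulMeasure_real_cylinder_glue hq μ ω le_rfl, Finset.prod_ne_zero_iff] at h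
  rw [info, mulMeasure_real_cylinder_glue hq μ ω le_rfl, Real.log_prod h,
    ← Finset.sum_neg_distrib]
  rfl

end Glue

/-! ### The Shannon–McMillan–Breiman theorem for `ℙ_μ` -/

/-- The sum of the `Y k ^ 2` has finite integral, hence is almost surely finite, and its terms tend
to zero. -/
theorem ae_tendsto_zero_of_summable_integral_sq {Ω' : Type*} [MeasurableSpace Ω']
    {ν : Measure Ω'} (Y : ℕ → Ω' → ℝ) (hm : ∀ k, Measurable (Y k))
    (hint : ∀ k, Integrable (fun ω => Y k ω ^ 2) ν)
    (hsum : Summable fun k => ∫ ω, Y k ω ^ 2 ∂ν) :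
    ∀ᵐ ω ∂ν, Tendsto (fun k => Y k ω) atTop (𝓝 0) := by
  have hm' : ∀ k, Measurable fun ω => ENNReal.ofReal (Y k ω ^ 2) := fun k =>
    ((hm k).pow_const 2).ennreal_ofReal
  have h1 : ∫⁻ ω, ∑' k, ENNReal.ofReal (Y k ω ^ 2) ∂ν ≠ ∞ := by
    rw [lintegral_tsum fun k => (hm' k).aemeasurable]
    simp_rw [← ofReal_integral_eq_lintegral_ofReal (hint _)
      (Eventually.of_forall fun ω => sq_nonneg (Y _ ω))]
    rw [← ENNReal.ofReal_tsum_of_nonneg (fun k => integral_nonneg fun ω => sq_nonneg _) hsum]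
    exact ENNReal.ofReal_ne_top
  filter_upwards [ae_lt_top (Measurable.tsum hm') h1] with ω hω
  have h2 := ENNReal.tendsto_atTop_zero_of_tsum_ne_top hω.ne
  have h3 : Tendsto (fun k => Y k ω ^ 2) atTop (𝓝 0) := by
    have := (ENNReal.tendsto_toReal ENNReal.zero_ne_top).comp h2
    refine this.congr fun k => ?_
    simp [ENNReal.toReal_ofReal (sq_nonneg (Y k ω))]
  have h4 := h3.sqrt
  simp_rw [Real.sqrt_sq_eq_abs, Real.sqrt_zero] at h4
  exact (tendsto_zero_iff_abs_tendsto_zero _).2 h4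

section SMB

variable {α : Type*} [MeasurableSpace α]

theorem ae_mulMeasure_of_ae_glue {q : ℕ} {μ : Measure (Seq α)} {p : Seq α → Prop}
    (hp : MeasurableSet {z | p z})
    (h : ∀ᵐ ω ∂(Measure.infinitePi fun _ : ℕ => μ), p (glue q ω)) :
    ∀ᵐ z ∂(mulMeasure q μ), p z :=
  (ae_map_iff (measurable_glue q).aemeasurable hp).2 h

theorem ae_glue_of_ae_mulMeasure {q : ℕ} {μ : Measure (Seq α)} {p : Seq α → Prop}
    (h : ∀ᵐ z ∂(mulMeasure q μ), p z) :
    ∀ᵐ ω ∂(Measure.infinitePi fun _ : ℕ => μ), p (glue q ω) :=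
  ae_of_ae_map (measurable_glue q).aemeasurable h

theorem integral_eval
    (μ : Measure (Seq α)) [IsProbabilityMeasure μ] {f : Seq α → ℝ} (hf : Measurable f) (i : ℕ) :
    ∫ ω, f (ω i) ∂(Measure.infinitePi fun _ : ℕ => μ) = ∫ z, f z ∂μ := by
  have h := (measurePreserving_eval_infinitePi (fun _ : ℕ => μ) i)
  rw [← h.map_eq, integral_map h.measurable.aemeasurable hf.aestronglyMeasurable, h.map_eq]

/-- Positivity of the cylinders matters: a null cylinder would have information `0` and break
monotonicity. -/
theorem info_mono (ν : Measure (Seq α)) [IsFiniteMeasure ν] (z : Seq α)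
    (hz : ∀ n, ν.real (PiNat.cylinder z n) ≠ 0) : Monotone fun n => info ν n z := by
  intro m n hmn
  refine neg_le_neg (Real.log_le_log (lt_of_le_of_ne measureReal_nonneg (hz n).symm) ?_)
  exact measureReal_mono (PiNat.cylinder_anti z hmn)

variable [Fintype α] [MeasurableSingletonClass α]

/-- The information of `ℙ_μ` along the progressions. -/
noncomputable def progInfo (q : ℕ) (μ : Measure (Seq α)) (n : ℕ) (ω : ℕ → Seq α) : ℝ :=
  ∑ i ∈ starts q n, info μ (progLen q n i) (ω i)

variable (q : ℕ) (μ : Measure (Seq α))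

theorem measurable_progInfo (n : ℕ) : Measurable (progInfo q μ n) :=
  Finset.measurable_sum _ fun i _ => (measurable_info μ _).comp (measurable_pi_apply i)

variable [IsProbabilityMeasure μ]

theorem memLp_info_eval (p i : ℕ) (r : ℝ≥0∞) :
    MemLp (fun ω : ℕ → Seq α => info μ p (ω i)) r (Measure.infinitePi fun _ : ℕ => μ) :=
  (memLp_info μ μ p r).comp_measurePreserving (measurePreserving_eval_infinitePi _ i)

theorem memLp_progInfo (n : ℕ) (r : ℝ≥0∞) :
    MemLp (progInfo q μ n) r (Measure.infinitePi fun _ : ℕ => μ) :=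
  memLp_finsetSum _ fun i _ => memLp_info_eval μ (progLen q n i) i r

theorem integral_progInfo (n : ℕ) :
    ∫ ω, progInfo q μ n ω ∂(Measure.infinitePi fun _ : ℕ => μ) =
      ∑ i ∈ starts q n, ent μ (progLen q n i) := by
  unfold progInfo
  rw [integral_finsetSum _ fun i _ => (memLp_info_eval μ (progLen q n i) i 1).integrable le_rfl]
  exact Finset.sum_congr rfl fun i _ => integral_eval μ (measurable_info μ _) i

/-- Different starts read independent samples, so variances add; each is at most the second moment.
-/
theorem variance_progInfo_le (n : ℕ) :
    Var[progInfo q μ n; Measure.infinitePi fun _ : ℕ => μ] ≤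
      ∑ i ∈ starts q n,
        (4 * Real.log (Fintype.card α) ^ 2 + 16) * (progLen q n i : ℝ) ^ 2 := by
  have h1 : progInfo q μ n =
      ∑ i ∈ starts q n, fun ω : ℕ → Seq α => info μ (progLen q n i) (ω i) := by
    ext ω
    simp [progInfo]
  rw [h1, IndepFun.variance_sum fun i _ => memLp_info_eval μ (progLen q n i) i 2]
  · refine Finset.sum_le_sum fun i _ => ?_
    refine (variance_le_expectation_sq
      (memLp_info_eval μ (progLen q n i) i 2).aestronglyMeasurable).trans ?_
    refine le_trans (le_of_eq ?_) (integral_info_sq_le μ (progLen q n i))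
    exact integral_eval μ ((measurable_info μ _).pow_const 2) i
  · intro i _ j _ hij
    exact (iIndepFun_infinitePi (P := fun _ : ℕ => μ)
      (X := fun i => info μ (progLen q n i)) fun i => measurable_info μ _).indepFun hij

theorem ae_info_glue_eq (hq : 2 ≤ q) :
    ∀ᵐ ω ∂(Measure.infinitePi fun _ : ℕ => μ), ∀ n,
      (mulMeasure q μ).real (PiNat.cylinder (glue q ω) n) ≠ 0 ∧
        info (mulMeasure q μ) n (glue q ω) = progInfo q μ n ω := by
  filter_upwards [ae_glue_of_ae_mulMeasure (ae_cylinder_ne_zero (mulMeasure q μ))] with ω hω n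
  exact ⟨hω n, info_mulMeasure_glue hq μ ω n (hω n)⟩

theorem ent_mulMeasure (hq : 2 ≤ q) (n : ℕ) :
    ent (mulMeasure q μ) n = ∑ i ∈ starts q n, ent μ (progLen q n i) := by
  rw [← integral_progInfo]
  refine (integral_map (measurable_glue q).aemeasurable
    (measurable_info _ n).aestronglyMeasurable).trans (integral_congr_ae ?_)
  filter_upwards [ae_info_glue_eq q μ hq] with ω hω
  exact (hω n).2

/-- The averages of the weight `p²` over progression lengths converge, hence are bounded. -/
theorem exists_variance_progInfo_le (hq : 2 ≤ q) :
    ∃ B : ℝ, ∀ n : ℕ,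
      Var[progInfo q μ n; Measure.infinitePi fun _ : ℕ => μ] ≤ B * n := by
  obtain ⟨l, hl⟩ := exists_tendsto_sum_progLen_div hq
    (fun p => (4 * Real.log (Fintype.card α) ^ 2 + 16) * (p : ℝ) ^ 2)
    (4 * Real.log (Fintype.card α) ^ 2 + 16) fun p => (abs_of_nonneg (by positivity)).le
  obtain ⟨B, hB⟩ := hl.bddAbove_range
  refine ⟨B, fun n => (variance_progInfo_le q μ n).trans ?_⟩
  rcases Nat.eq_zero_or_pos n with rfl | hn
  · simp [starts]
  · have hn' : (0 : ℝ) < n := by exact_mod_cast hn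
    rw [← div_le_iff₀ hn']
    exact hB ⟨n, rfl⟩

/-- At `n = k²` the normalised deviation has second moment at most `B k² / k⁴ = B / k²`, which is
summable. -/
theorem ae_tendsto_progInfo_sq (hq : 2 ≤ q) :
    ∀ᵐ ω ∂(Measure.infinitePi fun _ : ℕ => μ),
      Tendsto (fun k : ℕ => (progInfo q μ (k ^ 2) ω - ent (mulMeasure q μ) (k ^ 2)) /
        ((k ^ 2 : ℕ) : ℝ)) atTop (𝓝 0) := by
  obtain ⟨B, hB⟩ := exists_variance_progInfo_le q μ hq
  refine ae_tendsto_zero_of_summable_integral_sq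
    (fun k ω => (progInfo q μ (k ^ 2) ω - ent (mulMeasure q μ) (k ^ 2)) / ((k ^ 2 : ℕ) : ℝ))
    (fun k => ((measurable_progInfo q μ _).sub_const _).div_const _) (fun k => ?_) ?_
  · simp_rw [div_pow]
    exact ((memLp_progInfo q μ (k ^ 2) 2).sub (memLp_const _)).integrable_sq.div_const _
  · refine Summable.of_nonneg_of_le (fun k => integral_nonneg fun ω => sq_nonneg _) (fun k => ?_)
      ((Real.summable_one_div_nat_pow.2 (one_lt_two)).mul_left B)
    simp_rw [div_pow]
    rw [integral_div, ent_mulMeasure q μ hq, ← integral_progInfo,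
      ← variance_eq_integral (measurable_progInfo q μ _).aemeasurable]
    rcases Nat.eq_zero_or_pos k with rfl | hk
    · simp
    · have hk' : (0 : ℝ) < k := by exact_mod_cast hk
      rw [div_le_iff₀ (by positivity)]
      refine (hB (k ^ 2)).trans (le_of_eq ?_)
      push_cast
      field_simp

/-- The entropy dimension of `ℙ_μ` exists, and it is the almost sure rate of decay of the measures
of the cylinders. -/
theorem exists_hasEntropyDim_and_ae_tendsto (hq : 2 ≤ q) :
    ∃ e, HasEntropyDim (mulMeasure q μ) e ∧ ∀ᵐ z ∂(mulMeasure q μ),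
      Tendsto (fun n : ℕ => info (mulMeasure q μ) n z / n) atTop (𝓝 e) := by
  obtain ⟨e, he⟩ := exists_tendsto_sum_progLen_div hq (ent μ) _ (abs_ent_le μ)
  have he' : Tendsto (fun n : ℕ => ent (mulMeasure q μ) n / n) atTop (𝓝 e) :=
    he.congr fun n => by rw [ent_mulMeasure q μ hq]
  refine ⟨e, (hasEntropyDim_iff _ e).2 he', ae_mulMeasure_of_ae_glue
    (measurableSet_tendsto _ fun n => (measurable_info _ n).div_const _) ?_⟩
  filter_upwards [ae_info_glue_eq q μ hq, ae_tendsto_progInfo_sq q μ hq] with ω hω hlim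
  have hsq : Tendsto (fun k : ℕ => k ^ 2) atTop atTop := tendsto_pow_atTop two_ne_zero
  -- Monotonicity of the information bridges the gaps between consecutive squares, because `(k + 1)²
  -- / k² → 1`.
  refine tendsto_div_of_monotone_of_exists_subseq_tendsto_div _ e
    (info_mono _ _ fun n => (hω n).1) fun a ha => ⟨fun k => k ^ 2, ?_, hsq, ?_⟩
  · have h1 : Tendsto (fun k : ℕ => (1 + 1 / (k : ℝ)) ^ 2) atTop (𝓝 1) := by
      have := ((tendsto_const_nhds (x := (1 : ℝ))).add
        tendsto_one_div_atTop_nhds_zero_nat).pow 2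
      simpa using this
    filter_upwards [h1.eventually (gt_mem_nhds ha), eventually_gt_atTop 0] with k hk hk0
    have hk' : (0 : ℝ) < k := by exact_mod_cast hk0
    push_cast
    calc ((k : ℝ) + 1) ^ 2 = (1 + 1 / (k : ℝ)) ^ 2 * (k : ℝ) ^ 2 := by field_simp
      _ ≤ a * (k : ℝ) ^ 2 := by gcongr
  · have h2 := hlim.add (he'.comp hsq)
    rw [zero_add] at h2
    refine h2.congr fun k => ?_
    simp only [Function.comp]
    rw [(hω (k ^ 2)).2, ← add_div, sub_add_cancel]

end SMB

/-! ### The measure of approximate squares -/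

section Square

variable {m₁ m₂ : ℕ}

theorem measurable_proj : Measurable (proj : Sig m₁ m₂ → Seq (Fin m₂)) := by
  unfold proj
  fun_prop

/-- The approximate square of the sequences that share with `z` the first `n` letters and the first
`l` second coordinates. -/
def square (z : Sig m₁ m₂) (n l : ℕ) : Set (Sig m₁ m₂) :=
  PiNat.cylinder z n ∩ proj ⁻¹' PiNat.cylinder (proj z) l

theorem measurableSet_square (z : Sig m₁ m₂) (n l : ℕ) : MeasurableSet (square z n l) :=
  (measurableSet_cylinder z n).inter (measurable_proj (measurableSet_cylinder _ l))

theorem proj_glue (q : ℕ) (ω : ℕ → Sig m₁ m₂) :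
    proj (glue q ω) = glue q fun i => proj (ω i) := rfl

theorem map_proj_mulMeasure (q : ℕ) (μ : Measure (Sig m₁ m₂)) [IsProbabilityMeasure μ] :
    (mulMeasure q μ).map proj = mulMeasure q (μ.map proj) := by
  have hp : Measurable fun (ω : ℕ → Sig m₁ m₂) i => proj (ω i) :=
    measurable_pi_lambda _ fun i => measurable_proj.comp (measurable_pi_apply i)
  have h := Measure.infinitePi_map_pi (fun _ : ℕ => μ) (f := fun _ => proj)
    fun _ => measurable_proj
  rw [mulMeasure, mulMeasure, ← h, Measure.map_map measurable_proj (measurable_glue q),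
    Measure.map_map (measurable_glue q) hp]
  rfl

theorem proj_image_cylinder (z : Sig m₁ m₂) (n : ℕ) :
    proj '' PiNat.cylinder z n = PiNat.cylinder (proj z) n := by
  ext y
  constructor
  · rintro ⟨w, hw, rfl⟩ k hk
    exact congrArg Prod.snd (hw k hk)
  · intro hy
    refine ⟨fun k => ((z k).1, y k), fun k hk => Prod.ext rfl (hy k hk), rfl⟩

/-- The disintegration formula on rectangles. -/
theorem measure_inter_proj_preimage (μ : Measure (Sig m₁ m₂)) [IsProbabilityMeasure μ]
    {s : Set (Sig m₁ m₂)} (hs : MeasurableSet s) {t : Set (Seq (Fin m₂))} (ht : MeasurableSet t) :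
    μ (s ∩ proj ⁻¹' t) = ∫⁻ y in t, disint μ y s ∂(μ.map proj) := by
  have : Nonempty (Sig m₁ m₂) := μ.nonempty_of_neZero
  have hc : μ.map proj ⊗ₘ disint μ = μ.map fun a => (proj a, id a) :=
    compProd_map_condDistrib aemeasurable_id
  have : IsMarkovKernel (disint μ) := by
    unfold disint
    infer_instance
  rw [← Measure.compProd_apply_prod ht hs, hc,
    Measure.map_apply (measurable_proj.prodMk measurable_id) (ht.prod hs)]
  congr 1
  ext z
  simp [and_comm]

/-- The conditional measures of the cylinders with base in `Ω` are almost surely constant. -/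
def FiberConst (Ω : Set (Sig m₁ m₂)) (μ : Measure (Sig m₁ m₂)) [IsProbabilityMeasure μ] : Prop :=
  ∀ p : ℕ, 1 ≤ p → ∀ u ∈ Pref Ω p, ∃ c : ℝ≥0∞,
    ∀ᵐ y ∂(μ.map proj), y ∈ proj '' cyl u → disint μ y (Ω ∩ cyl u) = c

variable {Ω : Set (Sig m₁ m₂)} {μ : Measure (Sig m₁ m₂)} [IsProbabilityMeasure μ]

/-- Integrating the constant fibre mass `c` over the base gives `μ (square z p k) = c * μ.map proj
(PiNat.cylinder (proj z) k)` for every `k ≥ p`. Comparing `k = l` with `k = p` eliminates `c`. The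
product form avoids division and so covers null cylinders. The case `p = 0`, outside the hypothesis,
is direct. -/
theorem FiberConst.measure_square_mul (hconst : FiberConst Ω μ) (hΩ : MeasurableSet Ω)
    (hμ : μ Ωᶜ = 0) (z : Sig m₁ m₂) {p l : ℕ} (hpl : p ≤ l) :
    μ (square z p l) * μ.map proj (PiNat.cylinder (proj z) p) =
      μ (PiNat.cylinder z p) * μ.map proj (PiNat.cylinder (proj z) l) := by
  rcases Nat.eq_zero_or_pos p with rfl | hp
  · have := Measure.isProbabilityMeasure_map (μ := μ) measurable_proj.aemeasurable
    simp [square, Measure.map_apply measurable_proj (measurableSet_cylinder _ _)]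
  have hΩ' : ∀ s : Set (Sig m₁ m₂), μ (Ω ∩ s) = μ s := fun s => by
    rw [Set.inter_comm]
    exact measure_inter_conull hμ
  by_cases hne : restr p z ∈ Pref Ω p
  · obtain ⟨c, hc⟩ := hconst p hp _ hne
    rw [cyl_restr, proj_image_cylinder] at hc
    have key : ∀ k, p ≤ k → μ (square z p k) = c * μ.map proj (PiNat.cylinder (proj z) k) := by
      intro k hk
      rw [← hΩ', square, ← Set.inter_assoc, measure_inter_proj_preimage μ
        (hΩ.inter (measurableSet_cylinder z p)) (measurableSet_cylinder _ k),
        ← setLIntegral_const]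
      refine setLIntegral_congr_fun_ae (measurableSet_cylinder _ k) ?_
      filter_upwards [hc] with y hy hyk
      exact hy (PiNat.cylinder_anti _ hk hyk)
    have h0 : square z p p = PiNat.cylinder z p := by
      refine Set.inter_eq_left.2 fun w hw => ?_
      rw [Set.mem_preimage, ← proj_image_cylinder]
      exact Set.mem_image_of_mem _ hw
    rw [key l hpl, ← h0, key p le_rfl]
    ring
  · have h0 : μ (PiNat.cylinder z p) = 0 := by
      rw [← hΩ', ← cyl_restr]
      rw [Pref, Set.mem_ofPred_eq, Set.not_nonempty_iff_eq_empty] at hne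
      rw [hne, measure_empty]
    have h1 : μ (square z p l) = 0 := measure_mono_null Set.inter_subset_left h0
    rw [h0, h1, zero_mul, zero_mul]

theorem progLen_mono {q n l : ℕ} (h : n ≤ l) (i : ℕ) : progLen q n i ≤ progLen q l i :=
  Nat.clog_mono_right q (Nat.succ_le_succ (Nat.div_le_div_right h))

theorem mulMeasure_real_square_glue {q : ℕ} (hq : 2 ≤ q) (μ : Measure (Sig m₁ m₂))
    [IsProbabilityMeasure μ] (ω : ℕ → Sig m₁ m₂) {n l : ℕ} (hn : n ≤ l) :
    (mulMeasure q μ).real (square (glue q ω) n l) =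
      ∏ i ∈ starts q l, μ.real (square (ω i) (progLen q n i) (progLen q l i)) := by
  have : glue q ⁻¹' square (glue q ω) n l =
      Set.pi (starts q l : Set ℕ) fun i => square (ω i) (progLen q n i) (progLen q l i) := by
    ext ω'
    simp only [square, Set.mem_preimage, Set.mem_inter_iff, proj_glue,
      glue_mem_cylinder_glue hq ω ω' hn, glue_mem_cylinder_glue hq _ (fun i => proj (ω' i)) le_rfl,
      Set.mem_pi, Finset.mem_coe]
    exact forall₂_and.symm
  rw [measureReal_def, mulMeasure, Measure.map_apply (measurable_glue q)
    (measurableSet_square _ _ _), this, Measure.infinitePi_pi _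
    (fun i _ => measurableSet_square _ _ _), ENNReal.toReal_prod]
  rfl

/-- The approximate square given by two words. -/
def wordSquare {n l : ℕ} (u : (Fin n → Fin m₁ × Fin m₂) × (Fin l → Fin m₂)) :
    Set (Sig m₁ m₂) := cyl u.1 ∩ proj ⁻¹' cyl u.2

/-- The two words that determine the approximate square around `z`. -/
def squareWord (n l : ℕ) (z : Sig m₁ m₂) : (Fin n → Fin m₁ × Fin m₂) × (Fin l → Fin m₂) :=
  (restr n z, restr l (proj z))

theorem wordSquare_squareWord (n l : ℕ) (z : Sig m₁ m₂) :
    wordSquare (squareWord n l z) = square z n l := by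
  simp only [wordSquare, squareWord, cyl_restr, square]

theorem mem_wordSquare_iff {n l : ℕ} {z : Sig m₁ m₂}
    {u : (Fin n → Fin m₁ × Fin m₂) × (Fin l → Fin m₂)} :
    z ∈ wordSquare u ↔ squareWord n l z = u := by
  simp [wordSquare, squareWord, cyl_eq_preimage, Prod.ext_iff]

theorem measurable_squareWord (n l : ℕ) : Measurable (squareWord (m₁ := m₁) (m₂ := m₂) n l) :=
  (measurable_restr n).prodMk ((measurable_restr l).comp measurable_proj)

theorem measurable_measureReal_square (ν : Measure (Sig m₁ m₂)) (n l : ℕ) :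
    Measurable fun z => ν.real (square z n l) := by
  simp_rw [← wordSquare_squareWord]
  exact (measurable_of_finite fun u => ν.real (wordSquare u)).comp (measurable_squareWord n l)

/-- `-log` of the measure of an approximate square. -/
theorem FiberConst.ae_neg_log_square {q : ℕ} (hconst : FiberConst Ω μ) (hΩ : MeasurableSet Ω)
    (hμ : μ Ωᶜ = 0) (hq : 2 ≤ q) :
    ∀ᵐ z ∂(mulMeasure q μ), ∀ n l : ℕ, n ≤ l →
      0 < (mulMeasure q μ).real (square z n l) ∧
      -Real.log ((mulMeasure q μ).real (square z n l)) = info (mulMeasure q μ) n z +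
        (info ((mulMeasure q μ).map proj) l (proj z) -
          info ((mulMeasure q μ).map proj) n (proj z)) := by
  have := Measure.isProbabilityMeasure_map (μ := μ) measurable_proj.aemeasurable
  have := Measure.isProbabilityMeasure_map (μ := mulMeasure q μ) measurable_proj.aemeasurable
  refine ae_all_iff.2 fun n => ae_all_iff.2 fun l => ?_
  by_cases hnl : n ≤ l
  swap
  · exact Eventually.of_forall fun z h => absurd h hnl
  have hm := measurable_measureReal_square (mulMeasure q μ) n l
  refine ae_mulMeasure_of_ae_glue ?_ ?_
  · simp only [hnl, true_imp_iff]
    exact (measurableSet_lt measurable_const hm).inter (measurableSet_eq_fun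
      (Real.measurable_log.comp hm).neg ((measurable_info _ n).add
        (((measurable_info _ l).comp measurable_proj).sub
          ((measurable_info _ n).comp measurable_proj))))
  have h1 := ae_glue_of_ae_mulMeasure (ae_cylinder_ne_zero (mulMeasure q μ))
  have h2 := ae_glue_of_ae_mulMeasure (ae_of_ae_map measurable_proj.aemeasurable
    (ae_cylinder_ne_zero ((mulMeasure q μ).map proj)))
  filter_upwards [h1, h2] with ω hω1 hω2 _
  -- All four measures factor over `starts q l`, so the identity for `μ` applies on each progression
  -- with lengths `progLen q n i ≤ progLen q l i`.
  have key : (mulMeasure q μ).real (square (glue q ω) n l) *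
      ((mulMeasure q μ).map proj).real (PiNat.cylinder (proj (glue q ω)) n) =
      (mulMeasure q μ).real (PiNat.cylinder (glue q ω) n) *
        ((mulMeasure q μ).map proj).real (PiNat.cylinder (proj (glue q ω)) l) := by
    rw [map_proj_mulMeasure, proj_glue, mulMeasure_real_square_glue hq μ ω hnl,
      mulMeasure_real_cylinder_glue hq μ ω hnl, mulMeasure_real_cylinder_glue hq _ _ hnl,
      mulMeasure_real_cylinder_glue hq (μ.map proj) _ le_rfl, ← Finset.prod_mul_distrib,
      ← Finset.prod_mul_distrib]
    refine Finset.prod_congr rfl fun i _ => ?_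
    simp only [measureReal_def, ← ENNReal.toReal_mul]
    rw [hconst.measure_square_mul hΩ hμ (ω i) (progLen_mono hnl i)]
  have hne : (mulMeasure q μ).real (square (glue q ω) n l) ≠ 0 := by
    intro h0
    rw [h0, zero_mul] at key
    exact mul_ne_zero (hω1 n) (hω2 l) key.symm
  refine ⟨lt_of_le_of_ne measureReal_nonneg hne.symm, ?_⟩
  have hlog := congrArg Real.log key
  rw [Real.log_mul hne (hω2 n), Real.log_mul (hω1 n) (hω2 l)] at hlog
  simp only [info]
  linarith

end Square

/-! ### Local dimension and Hausdorff dimension -/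

section LocalDim

open scoped NNReal

variable {X : Type*} [MetricSpace X] [MeasurableSpace X]

/-- The measure of the closed balls of radius `b⁻¹ ^ n` around `z` decays like `b ^ (-D n)`. -/
def HasLocalDim (ν : Measure X) (b D : ℝ) (z : X) : Prop :=
  (∀ n : ℕ, 0 < ν.real (Metric.closedBall z (b⁻¹ ^ n))) ∧
    Tendsto (fun n : ℕ => -Real.log (ν.real (Metric.closedBall z (b⁻¹ ^ n))) / n) atTop
      (𝓝 (D * Real.log b))

variable {ν : Measure X} {b D : ℝ} {z : X}

theorem inv_pow_rpow (hb : 1 < b) (n : ℕ) (s : ℝ) :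
    (b⁻¹ ^ n) ^ s = Real.exp (-(n * (s * Real.log b))) := by
  rw [Real.rpow_def_of_pos (by positivity), Real.log_pow, Real.log_inv]
  ring_nf

theorem HasLocalDim.eventually_le (h : HasLocalDim ν b D z) (hb : 1 < b) {s : ℝ} (hs : s < D) :
    ∀ᶠ n : ℕ in atTop, ν.real (Metric.closedBall z (b⁻¹ ^ n)) ≤ (b⁻¹ ^ n) ^ s := by
  have hlog := Real.log_pos hb
  filter_upwards [h.2.eventually (lt_mem_nhds (mul_lt_mul_of_pos_right hs hlog)),
    eventually_gt_atTop 0] with n hn hn0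
  have hn0' : (0 : ℝ) < n := by exact_mod_cast hn0
  rw [lt_div_iff₀ hn0'] at hn
  rw [inv_pow_rpow hb, ← Real.log_le_iff_le_exp (h.1 n)]
  linarith

theorem HasLocalDim.eventually_ge (h : HasLocalDim ν b D z) (hb : 1 < b) {s : ℝ} (hs : D < s) :
    ∀ᶠ n : ℕ in atTop, (b⁻¹ ^ n) ^ s ≤ ν.real (Metric.closedBall z (b⁻¹ ^ n)) := by
  have hlog := Real.log_pos hb
  filter_upwards [h.2.eventually (gt_mem_nhds (mul_lt_mul_of_pos_right hs hlog)),
    eventually_gt_atTop 0] with n hn hn0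
  have hn0' : (0 : ℝ) < n := by exact_mod_cast hn0
  rw [div_lt_iff₀ hn0'] at hn
  rw [inv_pow_rpow hb, ← Real.le_log_iff_exp_le (h.1 n)]
  linarith

theorem tendsto_inv_pow_rpow (hb : 1 < b) {s : ℝ} (hs : 0 < s) :
    Tendsto (fun n : ℕ => (b⁻¹ ^ n : ℝ) ^ s) atTop (𝓝 0) := by
  have h := tendsto_pow_atTop_nhds_zero_of_lt_one (r := b⁻¹) (by positivity)
    (inv_lt_one_of_one_lt₀ hb)
  have := h.rpow_const (p := s) (Or.inr hs.le)
  rwa [Real.zero_rpow hs.ne'] at this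

/-- A set on which the balls are uniformly small: the measure is at most a multiple of the power
of the diameter. -/
theorem measure_le_ediam_rpow [IsFiniteMeasure ν] (hb : 1 < b) {s : ℝ} (hs : 0 < s) {N : ℕ}
    {E t : Set X}
    (hE : ∀ z ∈ E, ∀ n ≥ N, ν.real (Metric.closedBall z (b⁻¹ ^ n)) ≤ (b⁻¹ ^ n) ^ s)
    (ht : Metric.ediam t ≤ ENNReal.ofReal (b⁻¹ ^ N)) :
    ν (t ∩ E) ≤ ENNReal.ofReal (b ^ s) * Metric.ediam t ^ s := by
  have hb0 : 0 < b := by linarith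
  rcases (t ∩ E).eq_empty_or_nonempty with h0 | ⟨z, hzt, hzE⟩
  · simp [h0]
  have hfin : Metric.ediam t ≠ ∞ := ne_top_of_le_ne_top ENNReal.ofReal_ne_top ht
  have hd0 : 0 ≤ Metric.diam t := Metric.diam_nonneg
  have hdiam : Metric.ediam t = ENNReal.ofReal (Metric.diam t) :=
    (ENNReal.ofReal_toReal hfin).symm
  have hdN : Metric.diam t ≤ b⁻¹ ^ N := by
    rw [hdiam] at ht
    exact (ENNReal.ofReal_le_ofReal_iff (by positivity)).1 ht
  have hball : ∀ n, Metric.diam t ≤ b⁻¹ ^ n →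
      ν.real (t ∩ E) ≤ ν.real (Metric.closedBall z (b⁻¹ ^ n)) := by
    intro n hn
    refine measureReal_mono fun w hw => ?_
    exact (Metric.dist_le_diam_of_mem (Metric.isBounded_iff_ediam_ne_top.2 hfin) hw.1 hzt).trans hn
  suffices h : ν.real (t ∩ E) ≤ b ^ s * Metric.diam t ^ s by
    rw [hdiam, ENNReal.ofReal_rpow_of_nonneg hd0 hs.le, ← ENNReal.ofReal_mul (by positivity),
      ← ofReal_measureReal]
    exact ENNReal.ofReal_le_ofReal h
  rcases hd0.eq_or_lt with hd | hd
  · rw [← hd, Real.zero_rpow hs.ne', mul_zero]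
    refine ge_of_tendsto (tendsto_inv_pow_rpow hb hs) ?_
    filter_upwards [eventually_ge_atTop N] with n hn
    exact (hball n (by rw [← hd]; positivity)).trans (hE z hzE n hn)
  · have hb1 : b⁻¹ < 1 := inv_lt_one_of_one_lt₀ hb
    -- The diameter lies between consecutive scales `b^{-(n+1)}` and `b^{-n}`; rounding up to the
    -- larger one costs the factor `b ^ s`.
    obtain ⟨n, hn1, hn2⟩ := exists_nat_pow_near_of_lt_one hd
      (hdN.trans (pow_le_one₀ (by positivity) hb1.le)) (inv_pos.2 hb0) hb1
    have hnN : N ≤ n := by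
      by_contra! hlt
      have : b⁻¹ ^ N ≤ b⁻¹ ^ (n + 1) := pow_le_pow_of_le_one (by positivity) hb1.le hlt
      linarith
    calc ν.real (t ∩ E) ≤ (b⁻¹ ^ n) ^ s := (hball n hn2).trans (hE z hzE n hnN)
      _ = (b * b⁻¹ ^ (n + 1)) ^ s := by
        rw [pow_succ]
        field_simp
      _ = b ^ s * (b⁻¹ ^ (n + 1)) ^ s := Real.mul_rpow hb0.le (by positivity)
      _ ≤ b ^ s * Metric.diam t ^ s := by gcongr

variable [BorelSpace X]

/-- Mass distribution principle. For `s < D` the ball estimate holds uniformly from some rank `N` on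
a part of `A` of positive measure, where a multiple of `ν` is then bounded by the `s`-dimensional
Hausdorff measure. -/
theorem ofReal_le_dimH_of_hasLocalDim [IsFiniteMeasure ν] (hb : 1 < b)
    (hm : ∀ n : ℕ, Measurable fun z => ν.real (Metric.closedBall z (b⁻¹ ^ n)))
    (h : ∀ᵐ z ∂ν, HasLocalDim ν b D z) {A : Set X} (hA : MeasurableSet A) (hA0 : ν A ≠ 0) :
    ENNReal.ofReal D ≤ dimH A := by
  refine ENNReal.le_of_forall_nnreal_lt fun s hs => ?_
  rcases eq_or_ne s 0 with rfl | hs0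
  · simp
  have hs0' : (0 : ℝ) < s := by exact_mod_cast pos_iff_ne_zero.2 hs0
  have hsD : (s : ℝ) < D := by
    rw [← ENNReal.ofReal_coe_nnreal] at hs
    exact (ENNReal.ofReal_lt_ofReal_iff_of_nonneg s.2).1 hs
  set G : ℕ → Set X := fun N =>
    {z | ∀ n ≥ N, ν.real (Metric.closedBall z (b⁻¹ ^ n)) ≤ (b⁻¹ ^ n) ^ (s : ℝ)} with hG
  have hGm : ∀ N, MeasurableSet (G N) := fun N => by
    simp only [hG, Set.ofPred_forall]
    exact MeasurableSet.iInter fun n => MeasurableSet.iInter fun _ =>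
      measurableSet_le (hm n) measurable_const
  obtain ⟨N, hN⟩ : ∃ N, ν (A ∩ G N) ≠ 0 := by
    by_contra! hnull
    have h1 : ν (⋃ N, A ∩ G N) = 0 := measure_iUnion_null hnull
    refine hA0 (measure_mono_null_ae ?_ h1)
    filter_upwards [h] with z hz hzA
    obtain ⟨N, hN⟩ := eventually_atTop.1 (hz.eventually_le hb hsD)
    exact Set.mem_iUnion.2 ⟨N, hzA, hN⟩
  have hE := hA.inter (hGm N)
  set c := ENNReal.ofReal (b ^ (s : ℝ)) with hc
  have hc0 : c ≠ 0 := (ENNReal.ofReal_pos.2 (by positivity)).ne'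
  have key : c⁻¹ • ν.restrict (A ∩ G N) ≤ μH[s] := by
    refine Measure.le_hausdorffMeasure _ _ (ENNReal.ofReal (b⁻¹ ^ N))
      (ENNReal.ofReal_pos.2 (by positivity)) fun t ht => ?_
    rw [Measure.smul_apply, Measure.restrict_apply' hE, smul_eq_mul,
      ENNReal.inv_mul_le_iff hc0 ENNReal.ofReal_ne_top]
    exact measure_le_ediam_rpow hb hs0' (fun z hz => hz.2) ht
  refine (le_dimH_of_hausdorffMeasure_ne_zero (s := A ∩ G N) ?_).trans
    (dimH_mono Set.inter_subset_left)
  have h2 := key (A ∩ G N)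
  rw [Measure.smul_apply, Measure.restrict_apply_self, smul_eq_mul] at h2
  exact (lt_of_lt_of_le (ENNReal.mul_pos (ENNReal.inv_ne_zero.2 ENNReal.ofReal_ne_top) hN) h2).ne'

/-- At each scale the balls form a finite partition, indexed by `code`, so no covering lemma is
needed. For `s > D`, each class meeting `G N` contributes at most its measure to the Hausdorff sum,
and the classes are disjoint, so the sum is at most `1`. -/
theorem dimH_hasLocalDim_le [IsProbabilityMeasure ν] (hb : 1 < b) {ι : ℕ → Type*}
    [∀ n, Fintype (ι n)] (code : ∀ n, X → ι n)
    (hcode : ∀ n z w, dist w z ≤ b⁻¹ ^ n ↔ code n w = code n z) :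
    dimH {z | HasLocalDim ν b D z} ≤ ENNReal.ofReal D := by
  by_contra! hlt
  obtain ⟨s, hDs, hsA⟩ := ENNReal.lt_iff_exists_nnreal_btwn.1 hlt
  refine hsA.not_ge ?_
  have hs0 : (0 : ℝ) < s := by exact_mod_cast zero_le.trans_lt hDs
  have hsD : D < s := by
    by_contra! hle
    have := ENNReal.ofReal_le_ofReal hle
    rw [ENNReal.ofReal_coe_nnreal] at this
    exact this.not_gt hDs
  have hb0 : 0 < b := by linarith
  set G : ℕ → Set X := fun N =>
    {z | ∀ n ≥ N, (b⁻¹ ^ n) ^ (s : ℝ) ≤ ν.real (Metric.closedBall z (b⁻¹ ^ n))} with hG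
  have hsub : {z | HasLocalDim ν b D z} ⊆ ⋃ N, G N := fun z hz => by
    obtain ⟨N, hN⟩ := eventually_atTop.1 (HasLocalDim.eventually_ge hz hb hsD)
    exact Set.mem_iUnion.2 ⟨N, hN⟩
  refine (dimH_mono hsub).trans ?_
  rw [dimH_iUnion]
  refine iSup_le fun N => dimH_le_of_hausdorffMeasure_ne_top ?_
  refine ne_top_of_le_ne_top ENNReal.one_ne_top ?_
  have hediam : ∀ n i, Metric.ediam {w | w ∈ G N ∧ code n w = i} ≤ ENNReal.ofReal (b⁻¹ ^ n) := by
    intro n i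
    refine Metric.ediam_le fun w hw w' hw' => ?_
    rw [edist_dist]
    exact ENNReal.ofReal_le_ofReal ((hcode n w' w).2 (hw.2.trans hw'.2.symm))
  have hr : Tendsto (fun n : ℕ => ENNReal.ofReal (b⁻¹ ^ n)) atTop (𝓝 0) := by
    have := ENNReal.tendsto_ofReal (tendsto_pow_atTop_nhds_zero_of_lt_one (r := b⁻¹)
      (by positivity) (inv_lt_one_of_one_lt₀ hb))
    rwa [ENNReal.ofReal_zero] at this
  refine (Measure.hausdorffMeasure_le_liminf_sum (s : ℝ) (G N) _ hr
    (fun n i => {w | w ∈ G N ∧ code n w = i})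
    (Eventually.of_forall hediam) (Eventually.of_forall fun n w hw =>
      Set.mem_iUnion.2 ⟨code n w, hw, rfl⟩)).trans ?_
  refine liminf_le_of_frequently_le' (Eventually.frequently ?_)
  filter_upwards [eventually_ge_atTop N] with n hn
  have hball : ∀ w, Metric.closedBall w (b⁻¹ ^ n) = code n ⁻¹' {code n w} := fun w => by
    ext w'
    exact hcode n w w'
  calc ∑ i, Metric.ediam {w | w ∈ G N ∧ code n w = i} ^ (s : ℝ)
      ≤ ∑ i, ν (code n ⁻¹' {i}) := by
        refine Finset.sum_le_sum fun i _ => ?_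
        rcases Set.eq_empty_or_nonempty {w | w ∈ G N ∧ code n w = i} with h0 | ⟨w, hw, rfl⟩
        · rw [h0, Metric.ediam_empty, ENNReal.zero_rpow_of_pos hs0]
          exact zero_le
        · rw [← hball, ← ofReal_measureReal]
          refine (ENNReal.rpow_le_rpow (hediam n _) hs0.le).trans ?_
          rw [ENNReal.ofReal_rpow_of_nonneg (by positivity) hs0.le]
          exact ENNReal.ofReal_le_ofReal (hw n hn)
    _ = ν (⋃ i, code n ⁻¹' {i}) := by
        rw [measure_iUnion, tsum_fintype]
        · exact fun i j hij => Disjoint.preimage _ (by simpa using hij)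
        · intro i
          by_cases hi : ∃ w, code n w = i
          · obtain ⟨w, rfl⟩ := hi
            rw [← hball]
            exact measurableSet_closedBall
          · have : code n ⁻¹' {i} = ∅ := Set.eq_empty_of_forall_notMem fun w hw => hi ⟨w, hw⟩
            rw [this]
            exact MeasurableSet.empty
    _ ≤ 1 := prob_le_one

end LocalDim

/-! ### The symbolic space as a metric space -/

/-- `b^{-s k} ≤ b^{-n}` means `k ≥ n / s`; the ceiling appears because `k` is an integer. -/
theorem sepDist_le_iff {α : Type*} {b s : ℝ} (hb : 1 < b) (hs : 0 < s) (x y : Seq α) (n : ℕ) :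
    sepDist b s x y ≤ b⁻¹ ^ n ↔ x ∈ PiNat.cylinder y ⌈(n : ℝ) / s⌉₊ := by
  have hb0 : 0 < b := by linarith
  by_cases hxy : x = y
  · subst hxy
    simp only [sepDist_self, PiNat.self_mem_cylinder, iff_true]
    positivity
  rw [PiNat.mem_cylinder_iff_le_firstDiff hxy, Nat.ceil_le, div_le_iff₀ hs]
  simp only [sepDist, hxy, if_false]
  rw [inv_pow, ← Real.rpow_natCast, ← Real.rpow_neg hb0.le, Real.rpow_le_rpow_left_iff hb]
  constructor <;> intro h <;> linarith

/-- The symbolic space, with the metric whose balls are the approximate squares. -/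
def Carpet (m₁ m₂ : ℕ) := Sig m₁ m₂

section Carpet

variable {m₁ m₂ : ℕ}

noncomputable instance : MetricSpace (Carpet m₁ m₂) := carpetMetric m₁ m₂

/-- This is the product σ-algebra; `borelSpace_carpet` identifies it with the Borel σ-algebra of the
metric. -/
instance : MeasurableSpace (Carpet m₁ m₂) := inferInstanceAs (MeasurableSpace (Sig m₁ m₂))

/-- The number of second coordinates that determine a ball of radius `m₁ ^ (-n)`. -/
noncomputable def sndLen (m₁ m₂ n : ℕ) : ℕ := ⌈(n : ℝ) / gam m₁ m₂⌉₊

theorem gam_pos (h₂ : 2 ≤ m₂) (h : m₂ < m₁) : 0 < gam m₁ m₂ :=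
  div_pos (Real.log_pos (by exact_mod_cast h₂)) (Real.log_pos (by exact_mod_cast (by omega)))

theorem gam_le_one (h₂ : 2 ≤ m₂) (h : m₂ < m₁) : gam m₁ m₂ ≤ 1 := by
  have h₂' : (0 : ℝ) < m₂ := by positivity
  refine div_le_one_of_le₀ (Real.log_le_log h₂' (by exact_mod_cast h.le))
    (Real.log_natCast_nonneg _)

theorem le_sndLen (h₂ : 2 ≤ m₂) (h : m₂ < m₁) (n : ℕ) : n ≤ sndLen m₁ m₂ n := by
  have h1 : (n : ℝ) ≤ n / gam m₁ m₂ := le_div_self (by positivity) (gam_pos h₂ h) (gam_le_one h₂ h)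
  exact_mod_cast h1.trans (Nat.le_ceil _)

theorem tendsto_sndLen_div (h₂ : 2 ≤ m₂) (h : m₂ < m₁) :
    Tendsto (fun n : ℕ => (sndLen m₁ m₂ n : ℝ) / n) atTop (𝓝 (Real.log m₁ / Real.log m₂)) := by
  have h1 := (tendsto_nat_ceil_mul_div_atTop (R := ℝ) (a := 1 / gam m₁ m₂)
    (one_div_nonneg.2 (gam_pos h₂ h).le)).comp tendsto_natCast_atTop_atTop
  have h2 : 1 / gam m₁ m₂ = Real.log m₁ / Real.log m₂ := by rw [gam, one_div_div]
  rw [← h2]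
  refine h1.congr fun n => ?_
  simp only [Function.comp, sndLen, one_div_mul_eq_div]

theorem carpetDist_le_iff (h₂ : 2 ≤ m₂) (h : m₂ < m₁) (z w : Sig m₁ m₂) (n : ℕ) :
    carpetDist w z ≤ (m₁ : ℝ)⁻¹ ^ n ↔ w ∈ square z n (sndLen m₁ m₂ n) := by
  have h1 : (1 : ℝ) < m₁ := by exact_mod_cast (by omega)
  rw [carpetDist, max_le_iff, sepDist_le_iff h1 one_pos, sepDist_le_iff h1 (gam_pos h₂ h), div_one,
    Nat.ceil_natCast]
  rfl

theorem closedBall_eq_square (h₂ : 2 ≤ m₂) (h : m₂ < m₁) (z : Carpet m₁ m₂) (n : ℕ) :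
    Metric.closedBall z ((m₁ : ℝ)⁻¹ ^ n) = square z n (sndLen m₁ m₂ n) :=
  Set.ext fun w => carpetDist_le_iff h₂ h z w n

theorem carpetDist_le_iff_squareWord (h₂ : 2 ≤ m₂) (h : m₂ < m₁) (n : ℕ) (z w : Sig m₁ m₂) :
    carpetDist w z ≤ (m₁ : ℝ)⁻¹ ^ n ↔
      squareWord n (sndLen m₁ m₂ n) w = squareWord n (sndLen m₁ m₂ n) z := by
  rw [← mem_wordSquare_iff, wordSquare_squareWord]
  exact carpetDist_le_iff h₂ h z w n

theorem exists_inv_pow_lt (h : 2 ≤ m₁) {ε : ℝ} (hε : 0 < ε) : ∃ n : ℕ, (m₁ : ℝ)⁻¹ ^ n < ε :=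
  exists_pow_lt_of_lt_one hε (inv_lt_one_of_one_lt₀ (by exact_mod_cast h))

theorem isOpen_eval_mem (h₂ : 2 ≤ m₂) (h : m₂ < m₁) (k : ℕ) (s : Set (Fin m₁ × Fin m₂)) :
    IsOpen (X := Carpet m₁ m₂) {z : Sig m₁ m₂ | z k ∈ s} := by
  have h0 : 0 < m₁ := by omega
  refine Metric.isOpen_iff.2 fun z (hz : (z : Sig m₁ m₂) k ∈ s) =>
    ⟨(m₁ : ℝ)⁻¹ ^ (k + 1), by positivity, fun w hw => ?_⟩
  have h1 := ((carpetDist_le_iff h₂ h z w (k + 1)).1 (le_of_lt hw)).1 k (Nat.lt_succ_self k)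
  rw [← h1] at hz
  exact hz

theorem exists_square_subset (h₂ : 2 ≤ m₂) (h : m₂ < m₁) {U : Set (Sig m₁ m₂)}
    (hU : IsOpen (X := Carpet m₁ m₂) U) {z : Sig m₁ m₂} (hz : z ∈ U) :
    ∃ n, square z n (sndLen m₁ m₂ n) ⊆ U := by
  obtain ⟨ε, hε, hball⟩ := Metric.isOpen_iff.1 hU z hz
  obtain ⟨n, hn⟩ := exists_inv_pow_lt (m₁ := m₁) (by omega) hε
  exact ⟨n, (closedBall_eq_square h₂ h z n).symm.subset.trans
    ((Metric.closedBall_subset_ball hn).trans hball)⟩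

/-- An open set is the union of the approximate squares it contains, and there are finitely many at
each scale. -/
theorem measurableSet_of_isOpen_carpet (h₂ : 2 ≤ m₂) (h : m₂ < m₁) {U : Set (Sig m₁ m₂)}
    (hU : IsOpen (X := Carpet m₁ m₂) U) : MeasurableSet U := by
  have hU' : U = ⋃ n, squareWord n (sndLen m₁ m₂ n) ⁻¹' {u | wordSquare u ⊆ U} := by
    ext z
    simp only [Set.mem_iUnion, Set.mem_preimage, Set.mem_ofPred_eq, wordSquare_squareWord]
    exact ⟨exists_square_subset h₂ h hU, fun ⟨n, hn⟩ =>
      hn ⟨PiNat.self_mem_cylinder _ _, PiNat.self_mem_cylinder _ _⟩⟩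
  rw [hU']
  exact MeasurableSet.iUnion fun n => measurable_squareWord n _ (Set.toFinite _).measurableSet

theorem borelSpace_carpet (h₂ : 2 ≤ m₂) (h : m₂ < m₁) : BorelSpace (Carpet m₁ m₂) := by
  refine ⟨le_antisymm ?_ ?_⟩
  · exact iSup_le fun k => MeasurableSpace.comap_le_iff_le_map.2 fun s _ =>
      MeasurableSpace.measurableSet_generateFrom (isOpen_eval_mem h₂ h k s)
  · exact MeasurableSpace.generateFrom_le fun U hU => measurableSet_of_isOpen_carpet h₂ h hU

theorem upperDimH_le_of_ae {ν : Measure (Sig m₁ m₂)} {S : Set (Sig m₁ m₂)} (hS : MeasurableSet S)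
    (h : ∀ᵐ z ∂ν, z ∈ S) : upperDimH ν ≤ carpetDimH S :=
  (iInf_le _ S).trans ((iInf_le _ hS).trans (iInf_le _ h))

theorem lowerDimH_le_upperDimH (ν : Measure (Sig m₁ m₂)) [IsProbabilityMeasure ν] :
    lowerDimH ν ≤ upperDimH ν := by
  refine le_iInf fun A => le_iInf fun hA => le_iInf fun hA0 => ?_
  refine (iInf_le _ A).trans ((iInf_le _ hA).trans (iInf_le _ ?_))
  have : ν A = 1 := (prob_compl_eq_zero_iff hA).1 hA0
  simp [this]

/-- If the measures of the approximate squares decay at the almost sure rate `D`, then the lower and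
the upper Hausdorff dimension are both `D`. -/
theorem dimH_eq_of_ae_tendsto (h₂ : 2 ≤ m₂) (h : m₂ < m₁) (ν : Measure (Sig m₁ m₂))
    [IsProbabilityMeasure ν] {D : ℝ}
    (hpos : ∀ᵐ z ∂ν, ∀ n, 0 < ν.real (square z n (sndLen m₁ m₂ n)))
    (hlim : ∀ᵐ z ∂ν, Tendsto (fun n : ℕ => -Real.log (ν.real (square z n (sndLen m₁ m₂ n))) / n)
      atTop (𝓝 (D * Real.log m₁))) :
    lowerDimH ν = ENNReal.ofReal D ∧ upperDimH ν = ENNReal.ofReal D := by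
  have hB := borelSpace_carpet h₂ h
  have hb : (1 : ℝ) < m₁ := by exact_mod_cast (by omega)
  have hm := fun n => measurable_measureReal_square ν n (sndLen m₁ m₂ n)
  let ν' : Measure (Carpet m₁ m₂) := ν
  have : IsProbabilityMeasure ν' := ‹IsProbabilityMeasure ν›
  have hloc : ∀ z : Carpet m₁ m₂, HasLocalDim ν' m₁ D z ↔
      (∀ n, 0 < ν.real (square z n (sndLen m₁ m₂ n))) ∧
      Tendsto (fun n : ℕ => -Real.log (ν.real (square z n (sndLen m₁ m₂ n))) / n)
        atTop (𝓝 (D * Real.log m₁)) := fun z => by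
    simp only [HasLocalDim, closedBall_eq_square h₂ h]
    rfl
  have hae : ∀ᵐ z ∂ν', HasLocalDim ν' m₁ D z := by
    filter_upwards [hpos, hlim] with z h1 h2
    exact (hloc z).2 ⟨h1, h2⟩
  -- The set of points of local dimension `D` serves as the full-measure witness for the upper
  -- dimension, which ranges over measurable sets only.
  have hmeas : MeasurableSet {z : Carpet m₁ m₂ | HasLocalDim ν' m₁ D z} := by
    refine (congrArg MeasurableSet (Set.ext hloc)).mpr (MeasurableSet.inter ?_ ?_)
    · change MeasurableSet {z : Sig m₁ m₂ | ∀ n, 0 < ν.real (square z n (sndLen m₁ m₂ n))}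
      simp only [Set.ofPred_forall]
      exact MeasurableSet.iInter fun n => measurableSet_lt measurable_const (hm n)
    · exact measurableSet_tendsto _ fun n => (Real.measurable_log.comp (hm n)).neg.div_const _
  have hlow : ENNReal.ofReal D ≤ lowerDimH ν := by
    refine le_iInf fun A => le_iInf fun hA => le_iInf fun hA0 => ?_
    refine ofReal_le_dimH_of_hasLocalDim (X := Carpet m₁ m₂) (ν := ν') hb (fun n => ?_) hae hA hA0
    have hball : (fun z : Carpet m₁ m₂ => ν'.real (Metric.closedBall z ((m₁ : ℝ)⁻¹ ^ n))) =
        fun z => ν.real (square z n (sndLen m₁ m₂ n)) :=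
      funext fun z => by rw [closedBall_eq_square h₂ h]; rfl
    rw [hball]
    exact hm n
  have hup : upperDimH ν ≤ ENNReal.ofReal D :=
    (upperDimH_le_of_ae hmeas hae).trans
      (dimH_hasLocalDim_le (X := Carpet m₁ m₂) (ν := ν') hb
        (fun n => squareWord n (sndLen m₁ m₂ n)) (carpetDist_le_iff_squareWord h₂ h))
  have hle := lowerDimH_le_upperDimH ν
  exact ⟨le_antisymm (hle.trans hup) hlow, le_antisymm hup (hlow.trans hle)⟩

end Carpet

end MulCarpet

/-! ### The Ledrappier–Young formula. -/

open MulCarpet in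
theorem mainTheorem3 (m₁ m₂ q : ℕ) (hm₂ : 2 ≤ m₂) (hm : m₂ < m₁) (hq : 2 ≤ q)
    (Ω : Set (Sig m₁ m₂)) (hΩ : IsClosed Ω)
    (μ : Measure (Sig m₁ m₂)) [IsProbabilityMeasure μ] (hμ : μ Ωᶜ = 0)
    (hconst : ∀ p : ℕ, 1 ≤ p → ∀ u ∈ Pref Ω p, ∃ c : ℝ≥0∞,
      ∀ᵐ y ∂(μ.map proj), y ∈ proj '' cyl u → disint μ y (Ω ∩ cyl u) = c) :
    ∃ e e' : ℝ, HasEntropyDim (mulMeasure q μ) e ∧ HasEntropyDim ((mulMeasure q μ).map proj) e' ∧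
      lowerDimH (mulMeasure q μ) =
        ENNReal.ofReal (1 / Real.log m₁ * e + (1 / Real.log m₂ - 1 / Real.log m₁) * e') ∧
      upperDimH (mulMeasure q μ) =
        ENNReal.ofReal (1 / Real.log m₁ * e + (1 / Real.log m₂ - 1 / Real.log m₁) * e') := by
  have := Measure.isProbabilityMeasure_map (μ := μ) measurable_proj.aemeasurable
  obtain ⟨e, he, hae⟩ := exists_hasEntropyDim_and_ae_tendsto q μ hq
  obtain ⟨e', he', hae'⟩ := exists_hasEntropyDim_and_ae_tendsto q (μ.map proj) hq
  rw [← map_proj_mulMeasure] at he' hae'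
  have hsq := FiberConst.ae_neg_log_square hconst hΩ.measurableSet hμ hq
  have hlen := le_sndLen hm₂ hm
  have hl₁ : 0 < Real.log m₁ := Real.log_pos (by exact_mod_cast (by omega))
  have hl₂ : 0 < Real.log m₂ := Real.log_pos (by exact_mod_cast hm₂)
  refine ⟨e, e', he, he', dimH_eq_of_ae_tendsto hm₂ hm _ ?_ ?_⟩
  · filter_upwards [hsq] with z hz n
    exact (hz n _ (hlen n)).1
  · filter_upwards [hsq, hae, ae_of_ae_map measurable_proj.aemeasurable hae'] with z hz h1 h2
    have hL : Tendsto (sndLen m₁ m₂) atTop atTop := tendsto_atTop_mono hlen tendsto_id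
    -- The projected information at length `L = sndLen m₁ m₂ n` is rescaled as `I'_L / n = (I'_L /
    -- L) (L / n)`.
    have h3 := h1.add (((h2.comp hL).mul (tendsto_sndLen_div hm₂ hm)).sub h2)
    have h4 : (1 / Real.log m₁ * e + (1 / Real.log m₂ - 1 / Real.log m₁) * e') * Real.log m₁ =
        e + (e' * (Real.log m₁ / Real.log m₂) - e') := by
      field_simp
    rw [h4]
    refine h3.congr' ?_
    filter_upwards [eventually_gt_atTop 0] with n hn
    have hn' : (n : ℝ) ≠ 0 := by exact_mod_cast hn.ne'
    have hL' : (sndLen m₁ m₂ n : ℝ) ≠ 0 := by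
      have := hlen n
      exact_mod_cast (by omega : sndLen m₁ m₂ n ≠ 0)
    rw [(hz n _ (hlen n)).2]
    simp only [Function.comp]
    field_simp
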